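/- **Model.** There are finitely many agents $i=1,\dots,N$. The state space $\mathbb X$ and the measurement spaces $\mathbb Y^i$ are standard Borel, the action spaces $\mathbb U^i$ are finite; $\mathbf y=(y^1,\dots,y^N)$, $\mathbf u=(u^1,\dots,u^N)$. The state evolves by a transition kernel $\mathcal T(dx_{t+1}\mid x_t,\mathbf u_t)$, and given $x_t$ agent $i$ measures $y^i_t\sim Q^i(dy\mid x_t)=h^i(x_t,y)\,\psi^i(dy)$, independently across agents, where $\psi^i$ is a probability measure on $\mathbb Y^i$ and $h^i\ge 0$ is jointly measurable. The stage cost $c:\mathbb X\times\mathbb U^1\times\dots\times\mathbb U^N\to\mathbb R$ is bounded and measurable, $\|c\|_\infty=\sup|c|$, and $\beta\in(0,1)$. Measurements and actions are shared every $K\ge1$ stages; put $\tilde\beta=\beta^K$. A (map-valued) action $a_q$ for period $q$ consists of measurable maps $f^i_{qK+r}:(y^i_{[qK,qK+r]},u^i_{[qK,qK+r-1]})\mapsto u^i_{qK+r}$ for $0\le r<K$ and all $i$. **Predictors.** For a probability measure $Z$ on $\mathbb X$ let $F(Z,\mathbf u,\mathbf y)(\cdot)=\dfrac{\int \mathcal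 T(\cdot\mid x,\mathbf u)\prod_i h^i(x,y^i)\,Z(dx)}{\int\prod_i h^i(x,y^i)\,Z(dx)}$; if the denominator is $0$ or $\infty$, put $F(Z,\mathbf u,\mathbf y)=\int\mathcal T(\cdot\mid x,\mathbf u)Z(dx)$. For $M\in\mathbb N$ and a window $I=(\mathbf y_{[(q-M)K,qK-1]},\mathbf u_{[(q-M)K,qK-1]})$ of the last $M$ periods, $\pi_q(\pi,I)$ is the result of applying $F$ successively along $I$, starting from $\pi$. **True sliding-window MDP.** The state is $\hat Z_q=(\pi_{q-M},I^M_q)$, where $\pi_{q-M}$ is a predictor (a probability measure on $\mathbb X$) and $I^M_q$ is the window of measurements and actions of the last $M$ periods. Given $\hat Z_q$ and $a_q$, the system is run for one period from $x_{qK}\sim\pi_q(\hat Z_q)$ with the maps $a_q$; the cost $r(\hat Z_q,a_q)$ is the expectation of $\sum_{k=0}^{K-1}\beta^{k}c(x_{qK+k},\mathbf u_{qK+k})$; then $\pi_{q-M}$ is updated along the oldest period, that period is dropped from the window, and the measurements and actions of the new period are appended. Policies choose $a_q$ measurably from $\hat Z_0,\dots,\hat Z_q$ (that is, each $u^i_{qK+r}$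 is a jointly measurable function of $\hat Z_0,\dots,\hat Z_q$ and of the private information of agent $i$); the cost from $\hat Z_0=\hat Z$ is $J(\hat Z,\gamma)=\sum_{q\ge0}\tilde\beta^q E^\gamma[r(\hat Z_q,a_q)]$, and $J(\hat Z)=\inf_\gamma J(\hat Z,\gamma)$. **Approximate MDP.** Fix a probability measure $\pi^*$ on $\mathbb X$. The approximate MDP has states $\hat Z^*_q=(\pi^*,I^M_q)$, the same cost $r$, and the same transitions, except that the predictor component of the state is reset to $\pi^*$ after each transition. **Theorem.** Let $\gamma^*$ be a stationary Markov policy that is optimal for the approximate MDP from every initial state, and apply it to the true MDP by $\gamma^*(\pi,I)=\gamma^*(\pi^*,I)$. Let $\hat Z_0=(\pi_{-M},I^M_0)$ have an arbitrary probability distribution, and let $$L_q=\sup_\gamma E^\gamma\big[\|\pi_q(\pi_{q-M},I^M_q)-\pi_q(\pi^*,I^M_q)\|_{TV}\big],$$ where the supremum is over the stationary Markov policies of the true MDP started from this distribution and $\|\mu-\nu\|_{TV}=2\sup_B|\mu(B)-\nu(B)|$. Then $\sum_{q}\tilde\beta^qL_q<\infty$, $J(\hat Z_0,\gamma^*)-J(\hat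 Z_0)$ is integrable, and $$E\big[J(\hat Z_0,\gamma^*)-J(\hat Z_0)\big]\le 2\,\frac{\|c\|_\infty}{1-\beta}\sum_{q=0}^\infty\tilde\beta^qL_q .$$ -/

import Mathlib

open MeasureTheory
open scoped ENNReal NNReal

noncomputable section

namespace PeriodicSharing

/-- A decentralized stochastic control model with agents `ι`, state space `X`, action spaces `U i`
and measurement spaces `Y i`.  `T` is the transition kernel `𝒯(dx' | x, u)`.  The measurement
channel of agent `i` is `Qⁱ(dy | x) = hⁱ(x, y) ψⁱ(dy)`, and `c` is the bounded stage cost. -/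
structure Model {ι : Type*} (X : Type*) [MeasurableSpace X]
    (U Y : ι → Type*) [∀ i, MeasurableSpace (U i)] [∀ i, MeasurableSpace (Y i)] where
  T : ProbabilityTheory.Kernel (X × (∀ i, U i)) X
  markov_T : ProbabilityTheory.IsMarkovKernel T
  ψ : ∀ i, Measure (Y i)
  prob_ψ : ∀ i, IsProbabilityMeasure (ψ i)
  h : ∀ i, X → Y i → ℝ≥0
  measurable_h : ∀ i, Measurable fun p : X × Y i => h i p.1 p.2
  lintegral_h : ∀ i x, ∫⁻ y, (h i x y : ℝ≥0∞) ∂(ψ i) = 1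
  c : X × (∀ i, U i) → ℝ
  measurable_c : Measurable c
  bounded_c : ∃ B, ∀ p, |c p| ≤ B

/-- A map-valued action for one sharing period of length `K`: at stage `r < K` agent `i` applies a
measurable map from its private information, the measurements `yⁱ_0, …, yⁱ_r` and the actions
`uⁱ_0, …, uⁱ_{r-1}` of the current period, to its action space. -/
structure BlockAction {ι : Type*} (U Y : ι → Type*) [∀ i, MeasurableSpace (U i)]
    [∀ i, MeasurableSpace (Y i)] (K : ℕ) where
  map : ∀ (r : Fin K) (i : ι), (Fin (r + 1) → Y i) → (Fin r → U i) → U i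
  measurable_map : ∀ (r : Fin K) (i : ι), Measurable fun p : (Fin (r + 1) → Y i) × (Fin r → U i) =>
    map r i p.1 p.2

/-- A (measurable) decision rule: it chooses a map-valued action on the basis of information in
`Ω`.  Equivalently, at every stage each agent's action is a measurable function of the common
information in `Ω` and its private information. -/
structure Rule {ι : Type*} (U Y : ι → Type*) [∀ i, MeasurableSpace (U i)]
    [∀ i, MeasurableSpace (Y i)] (K : ℕ) (Ω : Type*) [MeasurableSpace Ω] where
  act : Ω → BlockAction U Y K
  measurable_act : ∀ (r : Fin K) (i : ι),
    Measurable fun p : Ω × ((Fin (r + 1) → Y i) × (Fin r → U i)) =>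
      (act p.1).map r i p.2.1 p.2.2

/-- The rule that uses only the part `f ω` of the information `ω`. -/
def Rule.comap {ι : Type*} {U Y : ι → Type*} [∀ i, MeasurableSpace (U i)]
    [∀ i, MeasurableSpace (Y i)] {K : ℕ} {Ω Ω' : Type*} [MeasurableSpace Ω] [MeasurableSpace Ω']
    (γ : Rule U Y K Ω') (f : Ω → Ω') (hf : Measurable f) : Rule U Y K Ω where
  act ω := γ.act (f ω)
  measurable_act r i :=
    (γ.measurable_act r i).comp ((hf.comp measurable_fst).prodMk measurable_snd)

/-! ### Generic discounted Markov decision processes with map-valued actions -/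

section MDP

variable {ι : Type*} {U Y : ι → Type*} [∀ i, MeasurableSpace (U i)] [∀ i, MeasurableSpace (Y i)]
  {K : ℕ} {S : Type*} [MeasurableSpace S]

/-- A policy: at every period `q` a measurable rule based on the states `s_0, …, s_q`. -/
abbrev Policy {ι : Type*} (U Y : ι → Type*) [∀ i, MeasurableSpace (U i)]
    [∀ i, MeasurableSpace (Y i)] (K : ℕ) (S : Type*) [MeasurableSpace S] :=
  ∀ q : ℕ, Rule U Y K (Fin (q + 1) → S)

/-- A stationary Markov policy, seen as a policy. -/
def stationary (γ : Rule U Y K S) : Policy U Y K S :=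
  fun q => γ.comap (fun s => s (Fin.last q)) (measurable_pi_apply _)

/-- The law of `(s_0, …, s_q)` when `s_0 ∼ ν`, the transition kernel is `θ(ds' | s, a)` and the
policy `γ` is used. -/
def stateLaw (θ : S → BlockAction U Y K → Measure S) (γ : Policy U Y K S) (ν : Measure S) :
    ∀ q : ℕ, Measure (Fin (q + 1) → S)
  | 0 => ν.map fun s _ => s
  | q + 1 => (stateLaw θ γ ν q).bind fun s =>
      (θ (s (Fin.last q)) ((γ q).act s)).map fun s' => (Fin.snoc s s' : Fin (q + 1 + 1) → S)

/-- The discounted cost `∑_q b^q E[r(s_q, a_q)]` of the policy `γ` started at `s`. -/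
def policyCost (θ : S → BlockAction U Y K → Measure S) (r : S → BlockAction U Y K → ℝ) (b : ℝ)
    (γ : Policy U Y K S) (s : S) : ℝ :=
  ∑' q : ℕ, b ^ q *
    ∫ p, r (p (Fin.last q)) ((γ q).act p) ∂(stateLaw θ γ (Measure.dirac s) q)

/-- The optimal value function: the infimum of the cost over all policies. -/
def optimalCost (θ : S → BlockAction U Y K → Measure S) (r : S → BlockAction U Y K → ℝ) (b : ℝ)
    (s : S) : ℝ :=
  ⨅ γ : Policy U Y K S, policyCost θ r b γ s

/-- The stationary Markov policy `γ` is optimal, simultaneously for all initial states. -/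
def IsOptimal (θ : S → BlockAction U Y K → Measure S) (r : S → BlockAction U Y K → ℝ) (b : ℝ)
    (γ : Rule U Y K S) : Prop :=
  ∀ (s : S) (γ' : Policy U Y K S),
    policyCost θ r b (stationary γ) s ≤ policyCost θ r b γ' s

end MDP

/-- The total variation distance `‖μ - ν‖_TV = 2 sup_B |μ(B) - ν(B)|`. -/
def tv {X : Type*} [MeasurableSpace X] (μ ν : Measure X) : ℝ :=
  2 * ⨆ B : {B : Set X // MeasurableSet B}, |μ.real B - ν.real B|

section Model

variable {ι : Type*} [Fintype ι] {X : Type*} [MeasurableSpace X] {U Y : ι → Type*}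
  [∀ i, MeasurableSpace (U i)] [∀ i, MeasurableSpace (Y i)]

/-- The joint measurements and actions of all agents during one period of `K` stages. -/
abbrev Block {ι : Type*} (U Y : ι → Type*) (K : ℕ) := Fin K → (∀ i, Y i) × (∀ i, U i)

/-- A window of the `M` most recent periods, the oldest one first. -/
abbrev Window {ι : Type*} (U Y : ι → Type*) (K M : ℕ) := Fin M → Block U Y K

/-- The state `(π_{q-M}, I^M_q)` of the sliding-window decision process: the predictor `M` periods
ago and the window of the measurements and actions since then. -/
abbrev State {ι : Type*} (X : Type*) [MeasurableSpace X] (U Y : ι → Type*) (K M : ℕ) :=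
  ProbabilityMeasure X × Window U Y K M

namespace Model

variable (m : Model X U Y)

/-- `‖c‖_∞`. -/
def costBound : ℝ := ⨆ p, |m.c p|

/-- The joint measurement channel `∏ᵢ Qⁱ(dyⁱ | x)`. -/
def channel (x : X) : Measure (∀ i, Y i) :=
  Measure.pi fun i => (m.ψ i).withDensity fun y => (m.h i x y : ℝ≥0∞)

/-- The joint likelihood `∏ᵢ hⁱ(x, yⁱ)`. -/
def likelihood (y : ∀ i, Y i) (x : X) : ℝ≥0∞ := ∏ i, (m.h i x (y i) : ℝ≥0∞)

/-- Bayes' rule: `Z` conditioned on the measurement `y`, with density proportional to the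
likelihood.  If the normalizing constant is not in `(0, ∞)`, then `Z` is left as it is. -/
def filter (Z : Measure X) (y : ∀ i, Y i) : Measure X :=
  open Classical in
  if (∫⁻ x, m.likelihood y x ∂Z) = 0 ∨ (∫⁻ x, m.likelihood y x ∂Z) = ∞ then Z
  else (∫⁻ x, m.likelihood y x ∂Z)⁻¹ • Z.withDensity (m.likelihood y)

theorem isProbabilityMeasure_filter (Z : Measure X) [IsProbabilityMeasure Z] (y : ∀ i, Y i) :
    IsProbabilityMeasure (m.filter Z y) := by
  unfold filter
  split_ifs with hZ
  · infer_instance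
  · push Not at hZ
    constructor
    rw [Measure.smul_apply, withDensity_apply _ MeasurableSet.univ, Measure.restrict_univ,
      smul_eq_mul]
    exact ENNReal.inv_mul_cancel hZ.1 hZ.2

/-- The one-stage update `F(Z, u, y)` of the predictor. -/
def update (Z : ProbabilityMeasure X) (z : (∀ i, Y i) × (∀ i, U i)) : ProbabilityMeasure X :=
  ⟨(m.filter Z z.1).bind fun x => m.T (x, z.2), by
    have := m.isProbabilityMeasure_filter (Z : Measure X) z.1
    have := m.markov_T
    exact isProbabilityMeasure_bind
      (m.T.measurable.comp (measurable_id.prodMk measurable_const)).aemeasurable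
      (Filter.Eventually.of_forall fun x => inferInstance)⟩

/-- The update `G` of the predictor over one period. -/
def blockUpdate {K : ℕ} (Z : ProbabilityMeasure X) (b : Block U Y K) : ProbabilityMeasure X :=
  Fin.foldl K (fun Z' r => m.update Z' (b r)) Z

/-- The current predictor `π_q(π_{q-M}, I^M_q)`, obtained from the predictor `M` periods ago by
updating it along the window. -/
def predictor {K M : ℕ} (s : State X U Y K M) : ProbabilityMeasure X :=
  Fin.foldl M (fun Z j => m.blockUpdate Z (s.2 j)) s.1

/-- The joint law of the first `r` stages `(x_k, y_k, u_k)`, `k < r`, of a period and of the state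
`x_r`, when `x_0 ∼ Z` and the map-valued action `a` is used. -/
def pathLaw {K : ℕ} (Z : Measure X) (a : BlockAction U Y K) :
    ∀ r : ℕ, r ≤ K → Measure ((Fin r → X × (∀ i, Y i) × (∀ i, U i)) × X)
  | 0, _ => Z.map fun x => (Fin.elim0, x)
  | r + 1, hr => (pathLaw Z a r (Nat.le_of_succ_le hr)).bind fun p =>
      (m.channel p.2).bind fun y =>
        let u : ∀ i, U i := fun i =>
          a.map ⟨r, hr⟩ i (Fin.snoc (fun k => (p.1 k).2.1 i) (y i)) (fun k => (p.1 k).2.2 i)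
        (m.T (p.2, u)).map fun x' =>
          ((Fin.snoc p.1 (p.2, y, u) : Fin (r + 1) → X × (∀ i, Y i) × (∀ i, U i)), x')

/-- The cost `E[∑_{k<K} β^k c(x_k, u_k)]` of one period, as a function of the predictor at its
beginning and of the map-valued action. -/
def blockCost {K : ℕ} (β : ℝ) (Z : Measure X) (a : BlockAction U Y K) : ℝ :=
  ∫ p, ∑ k : Fin K, β ^ (k : ℕ) * m.c ((p.1 k).1, (p.1 k).2.2) ∂(m.pathLaw Z a K le_rfl)

/-- The law of the joint measurements and actions of one period. -/
def blockLaw {K : ℕ} (Z : Measure X) (a : BlockAction U Y K) : Measure (Block U Y K) :=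
  (m.pathLaw Z a K le_rfl).map fun p k => (p.1 k).2

/-- The next sliding-window state once the period `b` has been observed: the old predictor is
updated along the oldest period, which is then dropped from the window. -/
def nextState {K M : ℕ} (s : State X U Y K M) (b : Block U Y K) : State X U Y K M :=
  let w : Fin (M + 1) → Block U Y K := Fin.snoc s.2 b
  (m.blockUpdate s.1 (w 0), Fin.tail w)

/-- The cost `r(s, a)` of the sliding-window decision process. -/
def cost {K M : ℕ} (β : ℝ) (s : State X U Y K M) (a : BlockAction U Y K) : ℝ :=
  m.blockCost β (m.predictor s) a

/-- The transition kernel of the true sliding-window decision process. -/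
def trans {K M : ℕ} (s : State X U Y K M) (a : BlockAction U Y K) : Measure (State X U Y K M) :=
  (m.blockLaw (m.predictor s) a).map (m.nextState s)

/-- The cost `r((π*, w), a)` of the approximate decision process, whose state `(π*, w)` is
identified with the window `w`. -/
def approxCost {K M : ℕ} (β : ℝ) (πs : ProbabilityMeasure X) (w : Window U Y K M)
    (a : BlockAction U Y K) : ℝ :=
  m.cost β (πs, w) a

/-- The transition kernel of the approximate decision process: the true one from `(π*, w)`, with
the predictor component of the new state reset to `π*`. -/
def approxTrans {K M : ℕ} (πs : ProbabilityMeasure X) (w : Window U Y K M)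
    (a : BlockAction U Y K) : Measure (Window U Y K M) :=
  (m.trans (πs, w) a).map Prod.snd

/-- `L_q`: the supremum over all stationary Markov policies of the true sliding-window decision
process of the expected total variation distance between the true predictor
`π_q(π_{q-M}, I^M_q)` and the approximate one `π_q(π*, I^M_q)`, where `(π_{-M}, I^M_0) ∼ ν`. -/
def predictorError {K M : ℕ} (πs : ProbabilityMeasure X) (ν : Measure (State X U Y K M))
    (q : ℕ) : ℝ :=
  ⨆ γ : Rule U Y K (State X U Y K M),
    ∫ p, tv (m.predictor (p (Fin.last q)) : Measure X)
        (m.predictor (πs, (p (Fin.last q)).2) : Measure X)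
      ∂(stateLaw m.trans (stationary γ) ν q)

end Model

end Model

end PeriodicSharing

end

noncomputable section

namespace PeriodicSharing

open ProbabilityTheory

/-! ### Measurability of parametrized integrals, and countable dense families. -/

section MeasureTheory

variable {Ω A E : Type*} [MeasurableSpace Ω] [MeasurableSpace A] [MeasurableSpace E]

/-! Let `V` be the optimal cost of the true process, `W` the cost of the transferred policy there,
and `A` the optimal cost of the approximate process, read as a function of the window alone. Put `C
= ‖c‖_∞ / (1 - β)`, which bounds all three. The loss is split as `(W - A) + (A - V)`, and each half
contributes `C * ∑ b ^ q * L_q` with `b = β ^ K`; this is the factor 2.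

For a function of the window, the Bellman expressions at `(π, I)` and at `(π*, I)` integrate the
same function of the path of one period; only the law of the initial state differs. That function is
bounded by `C`, so the two expressions differ by at most `C` times the total variation distance `d`
of the current predictors (`bellman_le_add_tv`, `periodBound_add`). Along the transferred policy,
`W` and `A` solve their Bellman equations, hence `W - A ≤ C * d + b * E[W - A]` at the next state.
Along a stationary policy that is greedy for `V` up to `ε`, the Bellman inequality for `A`
(`le_bellman_of_isOptimal`) gives `A - V ≤ C * d + ε + b * E[A - V]`. Iteration bounds the means by
the discounted sum of the expected distances (`integral_le_tsum_predictorError`). Both policies are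
stationary Markov, so the supremum defining `L_q` applies to them.

The delicate point is that `V` is measurable and has measurable, nearly greedy stationary policies,
although map-valued actions carry no measurable structure. The action spaces are finite and the
σ-algebras of the measurement spaces countably generated, so a single sequence of actions
approximates every action in the law of the path, whatever the initial law
(`exists_seq_blockAction_dense`). The Bellman infimum may then be taken over this sequence, and the
first good index is a measurable selector (`optimalCost_of_dense`). -/

theorem integrable_of_abs_le {μ : Measure A} [IsFiniteMeasure μ] {f : A → ℝ} (hf : Measurable f)
    {B : ℝ} (hB : ∀ a, |f a| ≤ B) : Integrable f μ :=
  Integrable.of_bound hf.aestronglyMeasurable B (Filter.Eventually.of_forall hB)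

theorem abs_integral_le_of_abs_le {μ : Measure A} [IsProbabilityMeasure μ] {f : A → ℝ}
    {B : ℝ} (hB : ∀ a, |f a| ≤ B) : |∫ a, f a ∂μ| ≤ B := by
  simpa using norm_integral_le_of_norm_le_const (μ := μ) (f := f) (Filter.Eventually.of_forall hB)

theorem isProbabilityMeasure_bind_of_measurable {μ : Measure A} [IsProbabilityMeasure μ]
    {κ : A → Measure E} (hκ : Measurable κ) (hκ' : ∀ a, IsProbabilityMeasure (κ a)) :
    IsProbabilityMeasure (μ.bind κ) :=
  isProbabilityMeasure_bind hκ.aemeasurable (Filter.Eventually.of_forall hκ')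

theorem integral_bind_of_abs_le {μ : Measure A} [IsProbabilityMeasure μ] {κ : A → Measure E}
    (hκ : Measurable κ) (hκ' : ∀ a, IsProbabilityMeasure (κ a)) {f : E → ℝ} (hf : Measurable f)
    {B : ℝ} (hB : ∀ e, |f e| ≤ B) : ∫ e, f e ∂(μ.bind κ) = ∫ a, ∫ e, f e ∂(κ a) ∂μ := by
  have := isProbabilityMeasure_bind_of_measurable (μ := μ) hκ hκ'
  have h : Integrable f (μ.bind κ) := integrable_of_abs_le hf hB
  exact Kernel.integral_comp (κ := Kernel.const Unit μ) (η := (⟨κ, hκ⟩ : Kernel A E)) (a := ()) h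

theorem measurable_lintegral_param {μ : Ω → Measure A} (hμ : Measurable μ)
    (hμ' : ∀ ω, IsProbabilityMeasure (μ ω)) {f : Ω × A → ℝ≥0∞} (hf : Measurable f) :
    Measurable fun ω => ∫⁻ a, f (ω, a) ∂(μ ω) := by
  let κ : Kernel Ω A := ⟨μ, hμ⟩
  have : IsMarkovKernel κ := ⟨hμ'⟩
  exact Measurable.lintegral_kernel_prod_right' (κ := κ) hf

theorem measurable_integral_param {μ : Ω → Measure A} (hμ : Measurable μ)
    (hμ' : ∀ ω, IsProbabilityMeasure (μ ω)) {f : Ω × A → ℝ} (hf : Measurable f) :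
    Measurable fun ω => ∫ a, f (ω, a) ∂(μ ω) := by
  let κ : Kernel Ω A := ⟨μ, hμ⟩
  have : IsMarkovKernel κ := ⟨hμ'⟩
  exact (StronglyMeasurable.integral_kernel_prod_right' (κ := κ) hf.stronglyMeasurable).measurable

theorem measurable_bind_param {μ : Ω → Measure A} (hμ : Measurable μ)
    (hμ' : ∀ ω, IsProbabilityMeasure (μ ω)) {κ : Ω × A → Measure E} (hκ : Measurable κ) :
    Measurable fun ω => (μ ω).bind fun a => κ (ω, a) := by
  refine Measure.measurable_of_measurable_coe _ fun s hs => ?_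
  have h : ∀ ω, Measurable fun a => κ (ω, a) := fun ω => hκ.comp measurable_prodMk_left
  simp_rw [fun ω => Measure.bind_apply (m := μ ω) hs (h ω).aemeasurable]
  exact measurable_lintegral_param hμ hμ' ((Measure.measurable_coe hs).comp hκ)

theorem measurable_map_param {μ : Ω → Measure A} (hμ : Measurable μ)
    (hμ' : ∀ ω, IsProbabilityMeasure (μ ω)) {g : Ω × A → E} (hg : Measurable g) :
    Measurable fun ω => (μ ω).map fun a => g (ω, a) := by
  have h : ∀ ω, Measurable fun a => g (ω, a) := fun ω => hg.comp measurable_prodMk_left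
  simp_rw [fun ω => (Measure.bind_dirac_eq_map (μ ω) (h ω)).symm]
  exact measurable_bind_param (κ := fun p => Measure.dirac (g p)) hμ hμ'
    (Measure.measurable_dirac.comp hg)

/-- A countably generated measurable space has a sequence of measurable sets which is dense for
every finite measure. -/
theorem exists_seq_measurableSet_dense (A : Type*) [m : MeasurableSpace A]
    [MeasurableSpace.CountablyGenerated A] :
    ∃ s : ℕ → Set A, (∀ n, MeasurableSet (s n)) ∧
      ∀ (μ : Measure A) [IsFiniteMeasure μ] (t : Set A), MeasurableSet t → ∀ ε : ℝ, 0 < ε →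
        ∃ n, μ (symmDiff t (s n)) < ENNReal.ofReal ε := by
  -- The algebra generated by a countable generating family is countable and still generates, and a
  -- generating algebra is dense for every finite measure.
  obtain ⟨s, hs⟩ := (countable_generateSetAlgebra
    (MeasurableSpace.countable_countableGeneratingSet (α := A))).exists_eq_range
    ⟨∅, self_subset_generateSetAlgebra MeasurableSpace.empty_mem_countableGeneratingSet⟩
  have hdense : ∀ (μ : Measure A) [IsFiniteMeasure μ], μ.MeasureDense (Set.range s) := by
    intro μ _
    rw [← hs]
    refine Measure.MeasureDense.of_generateFrom_isSetAlgebra_finite μ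
      isSetAlgebra_generateSetAlgebra ?_
    rw [generateFrom_generateSetAlgebra_eq, MeasurableSpace.generateFrom_countableGeneratingSet]
  -- Density includes measurability of the members, so any measure, here `0`, yields it.
  refine ⟨s, fun n => (hdense 0).measurable _ ⟨n, rfl⟩, fun μ _ t ht ε hε => ?_⟩
  obtain ⟨_, ⟨n, rfl⟩, hn⟩ := (hdense μ).approx t ht (measure_ne_top _ _) ε hε
  exact ⟨n, hn⟩

/-- Countably many measurable maps to a finite space are dense in measure, for all finite measures
simultaneously. -/
theorem exists_seq_measurable_dense (A V : Type*) [MeasurableSpace A]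
    [MeasurableSpace.CountablyGenerated A] [MeasurableSpace V] [Finite V] [Nonempty V]
    [DiscreteMeasurableSpace V] :
    ∃ g : ℕ → A → V, (∀ n, Measurable (g n)) ∧
      ∀ (μ : Measure A) [IsFiniteMeasure μ] (f : A → V), Measurable f → ∀ ε : ℝ, 0 < ε →
        ∃ n, μ {a | f a ≠ g n a} < ENNReal.ofReal ε := by
  classical
  have := Fintype.ofFinite V
  obtain ⟨s, hs, hdense⟩ := exists_seq_measurableSet_dense A
  -- A map to `V` is rebuilt from approximate level sets, which need not partition the space: `pick`
  -- returns the right value when exactly one level set contains the point, and some value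
  -- otherwise.
  let pick : (V → Prop) → V := fun p => if h : ∃ v, p v then h.choose else Classical.arbitrary V
  have pick_eq : ∀ v, pick (fun w => v = w) = v := by
    intro v
    have h : ∃ w, v = w := ⟨v, rfl⟩
    have := h.choose_spec
    simp only [pick, dif_pos h]
    exact this.symm
  -- Since `V` is finite, the assignments of one dense set to each value are countable.
  obtain ⟨e, he⟩ := exists_surjective_nat (V → ℕ)
  refine ⟨fun n a => pick fun v => a ∈ s (e n v), fun n => ?_, fun μ _ f hf ε hε => ?_⟩
  · exact (measurable_of_finite pick).comp
      (measurable_pi_iff.2 fun v => measurable_to_prop (by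
        convert hs (e n v) using 1; ext a; simp))
  · have hc : (0 : ℝ) < Fintype.card V := by exact_mod_cast Fintype.card_pos
    choose k hk using fun v => hdense μ (f ⁻¹' {v}) (hf (measurableSet_singleton v))
      (ε / Fintype.card V) (by positivity)
    obtain ⟨n, hn⟩ := he k
    refine ⟨n, ?_⟩
    have hsub : {a | f a ≠ pick fun v => a ∈ s (e n v)} ⊆
        ⋃ v ∈ (Finset.univ : Finset V), symmDiff (f ⁻¹' {v}) (s (k v)) := by
      intro a ha
      by_contra hcon
      simp only [Finset.mem_univ, Set.iUnion_true, Set.mem_iUnion, not_exists, Set.mem_symmDiff,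
        Set.mem_preimage, Set.mem_singleton_iff] at hcon
      refine ha ?_
      have : (fun v => a ∈ s (e n v)) = fun w => f a = w := by
        funext v
        have := hcon v
        rw [hn]
        exact propext (by tauto)
      rw [this, pick_eq]
    calc μ {a | f a ≠ pick fun v => a ∈ s (e n v)}
        ≤ ∑ v, μ (symmDiff (f ⁻¹' {v}) (s (k v))) :=
          (measure_mono hsub).trans (measure_biUnion_finset_le _ _)
      _ < ∑ _v : V, ENNReal.ofReal (ε / Fintype.card V) :=
          ENNReal.sum_lt_sum_of_nonempty Finset.univ_nonempty fun v _ => hk v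
      _ = ENNReal.ofReal ε := by
          rw [← ENNReal.ofReal_sum_of_nonneg fun _ _ => by positivity]
          congr 1
          simp only [Finset.sum_const, Finset.card_univ, nsmul_eq_mul]
          field_simp

/-! ### Total variation distance. -/

section TotalVariation

theorem bddAbove_abs_measureReal_sub (μ ν : Measure A) [IsProbabilityMeasure μ]
    [IsProbabilityMeasure ν] :
    BddAbove (Set.range fun B : {B : Set A // MeasurableSet B} => |μ.real B - ν.real B|) := by
  refine ⟨1, ?_⟩
  rintro _ ⟨B, rfl⟩
  have h1 : μ.real B ≤ 1 := measureReal_le_one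
  have h2 : ν.real B ≤ 1 := measureReal_le_one
  have h3 : 0 ≤ μ.real B := measureReal_nonneg
  have h4 : 0 ≤ ν.real B := measureReal_nonneg
  exact abs_le.2 ⟨by linarith, by linarith⟩

theorem two_mul_abs_measureReal_sub_le_tv (μ ν : Measure A) [IsProbabilityMeasure μ]
    [IsProbabilityMeasure ν] {B : Set A} (hB : MeasurableSet B) :
    2 * |μ.real B - ν.real B| ≤ tv μ ν :=
  mul_le_mul_of_nonneg_left (le_ciSup (bddAbove_abs_measureReal_sub μ ν) ⟨B, hB⟩) zero_le_two

theorem tv_nonneg (μ ν : Measure A) : 0 ≤ tv μ ν :=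
  mul_nonneg zero_le_two (Real.iSup_nonneg fun _ => abs_nonneg _)

theorem tv_le_two (μ ν : Measure A) [IsProbabilityMeasure μ] [IsProbabilityMeasure ν] :
    tv μ ν ≤ 2 := by
  have : Nonempty {B : Set A // MeasurableSet B} := ⟨⟨∅, MeasurableSet.empty⟩⟩
  have : ⨆ B : {B : Set A // MeasurableSet B}, |μ.real B - ν.real B| ≤ 1 := by
    refine ciSup_le fun B => ?_
    have h1 : μ.real B ≤ 1 := measureReal_le_one
    have h2 : ν.real B ≤ 1 := measureReal_le_one
    have h3 : 0 ≤ μ.real B := measureReal_nonneg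
    have h4 : 0 ≤ ν.real B := measureReal_nonneg
    exact abs_le.2 ⟨by linarith, by linarith⟩
  unfold tv
  linarith

theorem tv_comm (μ ν : Measure A) : tv μ ν = tv ν μ := by
  simp only [tv, abs_sub_comm]

/-- Layer cake: `f + B` takes values in `[0, 2 * B]`, and the measures of each of its level sets
differ by at most `tv μ ν / 2`. Integrating over levels in an interval of length `2 * B` gives the
constant `B`. -/
theorem integral_le_integral_add_tv (μ ν : Measure A) [IsProbabilityMeasure μ]
    [IsProbabilityMeasure ν] {f : A → ℝ} (hf : Measurable f) {B : ℝ} (hB : ∀ a, |f a| ≤ B) :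
    ∫ a, f a ∂μ ≤ ∫ a, f a ∂ν + B * tv μ ν := by
  have hne : Nonempty A := nonempty_of_isProbabilityMeasure μ
  have hB0 : 0 ≤ B := (abs_nonneg _).trans (hB hne.some)
  let g : A → ℝ := fun a => f a + B
  have hg : Measurable g := hf.add_const B
  have hg0 : ∀ a, 0 ≤ g a := fun a => by have := abs_le.1 (hB a); simp only [g]; linarith
  have hg1 : ∀ a, g a ≤ 2 * B := fun a => by have := abs_le.1 (hB a); simp only [g]; linarith
  have layer : ∀ (ρ : Measure A), ∫⁻ a, ENNReal.ofReal (g a) ∂ρ =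
      ∫⁻ t in Set.Ioc 0 (2 * B), ρ {a | t < g a} := by
    intro ρ
    rw [lintegral_eq_lintegral_meas_lt ρ (Filter.Eventually.of_forall hg0) hg.aemeasurable,
      ← Set.Ioc_union_Ioi_eq_Ioi (b := 2 * B) (by linarith),
      lintegral_union measurableSet_Ioi (Set.Ioc_disjoint_Ioi le_rfl)]
    convert add_zero _
    rw [setLIntegral_congr_fun (g := fun _ => 0) measurableSet_Ioi, lintegral_zero]
    intro t ht
    have : {a | t < g a} = ∅ := by
      ext a
      simpa using (hg1 a).trans (le_of_lt ht)
    simp [this]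
  have key : ∫⁻ a, ENNReal.ofReal (g a) ∂μ ≤
      ∫⁻ a, ENNReal.ofReal (g a) ∂ν + ENNReal.ofReal (B * tv μ ν) := by
    rw [layer, layer]
    calc ∫⁻ t in Set.Ioc 0 (2 * B), μ {a | t < g a}
        ≤ ∫⁻ t in Set.Ioc 0 (2 * B), (ν {a | t < g a} + ENNReal.ofReal (tv μ ν / 2)) := by
          refine lintegral_mono fun t => ?_
          have hm : MeasurableSet {a | t < g a} := measurableSet_lt measurable_const hg
          have h := two_mul_abs_measureReal_sub_le_tv μ ν hm
          have h' := le_abs_self (μ.real {a | t < g a} - ν.real {a | t < g a})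
          rw [← ofReal_measureReal (μ := μ), ← ofReal_measureReal (μ := ν),
            ← ENNReal.ofReal_add measureReal_nonneg (by linarith [tv_nonneg μ ν])]
          exact ENNReal.ofReal_le_ofReal (by linarith)
      _ = (∫⁻ t in Set.Ioc 0 (2 * B), ν {a | t < g a}) + ENNReal.ofReal (B * tv μ ν) := by
          rw [lintegral_add_right _ measurable_const]
          congr 1
          rw [lintegral_const, Measure.restrict_apply MeasurableSet.univ, Set.univ_inter,
            Real.volume_Ioc, ← ENNReal.ofReal_mul (by linarith [tv_nonneg μ ν])]
          congr 1
          ring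
  have hfi : ∀ (ρ : Measure A) [IsProbabilityMeasure ρ],
      ∫⁻ a, ENNReal.ofReal (g a) ∂ρ = ENNReal.ofReal (∫ a, f a ∂ρ + B) := by
    intro ρ _
    have hi : Integrable f ρ := integrable_of_abs_le hf hB
    rw [← ofReal_integral_eq_lintegral_ofReal (f := g) (hi.add (integrable_const B))
      (Filter.Eventually.of_forall hg0)]
    congr 1
    simp only [g]
    rw [integral_add hi (integrable_const B)]
    simp
  have hpos : 0 ≤ ∫ a, f a ∂ν + B := by
    have := abs_le.1 (abs_integral_le_of_abs_le (μ := ν) hB)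
    linarith
  rw [hfi μ, hfi ν, ← ENNReal.ofReal_add hpos (mul_nonneg hB0 (tv_nonneg μ ν)),
    ENNReal.ofReal_le_ofReal_iff (add_nonneg hpos (mul_nonneg hB0 (tv_nonneg μ ν)))] at key
  linarith

/-- The supremum over all measurable sets may be restricted to a sequence that is dense for all the
measures at once, and a countable supremum of measurable functions is measurable. -/
theorem measurable_tv [MeasurableSpace.CountablyGenerated A] {μ ν : Ω → Measure A}
    (hμ : Measurable μ) (hν : Measurable ν) (hμ' : ∀ ω, IsProbabilityMeasure (μ ω))
    (hν' : ∀ ω, IsProbabilityMeasure (ν ω)) : Measurable fun ω => tv (μ ω) (ν ω) := by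
  obtain ⟨s, hs, hdense⟩ := exists_seq_measurableSet_dense A
  have hm : ∀ {ρ : Ω → Measure A}, Measurable ρ → ∀ n, Measurable fun ω => (ρ ω).real (s n) :=
    fun hρ n => ((Measure.measurable_coe (hs n)).comp hρ).ennreal_toReal
  have hb : ∀ ω, BddAbove (Set.range fun n => |(μ ω).real (s n) - (ν ω).real (s n)|) := by
    intro ω
    refine (bddAbove_abs_measureReal_sub (μ ω) (ν ω)).mono ?_
    rintro _ ⟨n, rfl⟩
    exact ⟨⟨s n, hs n⟩, rfl⟩
  have heq : ∀ ω, tv (μ ω) (ν ω) = 2 * ⨆ n, |(μ ω).real (s n) - (ν ω).real (s n)| := by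
    intro ω
    have : Nonempty {B : Set A // MeasurableSet B} := ⟨⟨∅, MeasurableSet.empty⟩⟩
    unfold tv
    congr 1
    refine le_antisymm (ciSup_le fun B => ?_) (ciSup_le fun n =>
      le_ciSup (bddAbove_abs_measureReal_sub (μ ω) (ν ω)) ⟨s n, hs n⟩)
    refine le_of_forall_pos_le_add fun ε hε => ?_
    -- Approximating in the sum controls both measures with the same set.
    obtain ⟨n, hn⟩ := hdense (μ ω + ν ω) B B.2 ε hε
    have hadd : (μ ω).real (symmDiff (B : Set A) (s n)) +
        (ν ω).real (symmDiff (B : Set A) (s n)) < ε := by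
      rw [← measureReal_add_apply, measureReal_def]
      exact (ENNReal.lt_ofReal_iff_toReal_lt (measure_ne_top _ _)).1 hn
    have h1 := abs_measureReal_sub_le_measureReal_symmDiff (μ := μ ω) B.2.nullMeasurableSet
      (hs n).nullMeasurableSet
    have h2 := abs_measureReal_sub_le_measureReal_symmDiff (μ := ν ω) B.2.nullMeasurableSet
      (hs n).nullMeasurableSet
    have h3 := le_ciSup (hb ω) n
    rw [abs_le] at h1 h2
    have h4 := abs_le.1 h3
    exact abs_le.2 ⟨by linarith, by linarith⟩
  simp_rw [heq]
  exact (Measurable.iSup fun n => ((hm hμ n).sub (hm hν n)).abs).const_mul 2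

end TotalVariation

end MeasureTheory

/-! ### Discounted recursions. -/

section Sequences

variable {b : ℝ}

theorem summable_geometric_mul (hb0 : 0 ≤ b) (hb1 : b < 1) {g : ℕ → ℝ} {D : ℝ}
    (hg : ∀ q, |g q| ≤ D) : Summable fun q => b ^ q * g q := by
  refine Summable.of_norm_bounded ((summable_geometric_of_lt_one hb0 hb1).mul_right D) fun q => ?_
  rw [Real.norm_eq_abs, abs_mul, abs_of_nonneg (pow_nonneg hb0 q)]
  exact mul_le_mul_of_nonneg_left (hg q) (pow_nonneg hb0 q)

/-- Unrolling the recursion `n` times leaves the remainder `b ^ n * v n`, which vanishes in the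
limit because `v` is bounded. -/
theorem le_tsum_of_le_add_mul (hb0 : 0 ≤ b) (hb1 : b < 1) {v g : ℕ → ℝ} {D : ℝ}
    (hv : ∀ q, |v q| ≤ D) (hg : Summable fun q => b ^ q * g q)
    (h : ∀ q, v q ≤ g q + b * v (q + 1)) : v 0 ≤ ∑' q, b ^ q * g q := by
  have hstep : ∀ n, v 0 ≤ ∑ q ∈ Finset.range n, b ^ q * g q + b ^ n * v n := by
    intro n
    induction n with
    | zero => simp
    | succ n ih =>
      rw [Finset.sum_range_succ]
      have := mul_le_mul_of_nonneg_left (h n) (pow_nonneg hb0 n)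
      calc v 0 ≤ _ := ih
        _ ≤ _ := by rw [pow_succ]; linarith
  have hlim : Filter.Tendsto (fun n => b ^ n * v n) Filter.atTop (nhds 0) :=
    (summable_geometric_mul hb0 hb1 hv).tendsto_atTop_zero
  have := hg.hasSum.tendsto_sum_nat.add hlim
  rw [add_zero] at this
  exact ge_of_tendsto' this hstep

theorem tsum_le_of_add_mul_le (hb0 : 0 ≤ b) (hb1 : b < 1) {v g : ℕ → ℝ} {D : ℝ}
    (hv : ∀ q, |v q| ≤ D) (hg : Summable fun q => b ^ q * g q)
    (h : ∀ q, g q + b * v (q + 1) ≤ v q) : ∑' q, b ^ q * g q ≤ v 0 := by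
  have := le_tsum_of_le_add_mul hb0 hb1 (v := fun q => -v q) (g := fun q => -g q) (D := D)
    (fun q => by simpa using hv q) (by simpa using hg.neg) (fun q => by linarith [h q])
  simp only [mul_neg, tsum_neg] at this
  linarith

end Sequences

/-- A contraction of the bounded measurable functions has a bounded measurable fixed point. -/
theorem exists_measurable_fixedPoint {S : Type*} [MeasurableSpace S] {b B : ℝ} (hb0 : 0 ≤ b)
    (hb1 : b < 1) (T : (S → ℝ) → S → ℝ)
    (hm : ∀ V D, Measurable V → (∀ s, |V s| ≤ D) → Measurable (T V))
    (hB : ∀ V D, Measurable V → (∀ s, |V s| ≤ D) → ∀ s, |T V s| ≤ B + b * D)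
    (hT : ∀ V W D δ, Measurable V → Measurable W → (∀ s, |V s| ≤ D) → (∀ s, |W s| ≤ D) →
      (∀ s, |V s - W s| ≤ δ) → ∀ s, |T V s - T W s| ≤ b * δ) :
    ∃ V : S → ℝ, Measurable V ∧ (∀ s, |V s| ≤ B / (1 - b)) ∧ ∀ s, T V s = V s := by
  -- A state is needed to see that `B` is nonnegative.
  rcases isEmpty_or_nonempty S with hS | ⟨⟨s₀⟩⟩
  · exact ⟨fun _ => 0, measurable_const, fun s => hS.elim s, fun s => hS.elim s⟩
  have h1b : 0 < 1 - b := by linarith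
  have hB0 : 0 ≤ B := by
    have := hB (fun _ => 0) 0 measurable_const (by simp) s₀
    rw [mul_zero, add_zero] at this
    exact (abs_nonneg _).trans this
  set D := B / (1 - b) with hD
  -- `D` is the fixed point of `D ↦ B + b * D`, so the iterates never leave the ball of radius `D`.
  have hBD : B + b * D = D := by rw [hD]; field_simp; ring
  -- Value iteration from `0` converges geometrically at each point, and pointwise limits preserve
  -- measurability.
  let W : ℕ → S → ℝ := fun n => T^[n] fun _ => 0
  have W_succ : ∀ n, W (n + 1) = T (W n) := fun n => Function.iterate_succ_apply' T n _
  have hW : ∀ n, Measurable (W n) ∧ ∀ s, |W n s| ≤ D := by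
    intro n
    induction n with
    | zero => exact ⟨measurable_const, fun s => by simpa [W] using div_nonneg hB0 h1b.le⟩
    | succ n ih =>
      rw [W_succ]
      exact ⟨hm _ D ih.1 ih.2, fun s => (hB _ D ih.1 ih.2 s).trans hBD.le⟩
  have hstep : ∀ n s, |W n s - W (n + 1) s| ≤ B * b ^ n := by
    intro n
    induction n with
    | zero =>
      intro s
      have := hB (fun _ => 0) 0 measurable_const (by simp) s
      simpa [W] using this
    | succ n ih =>
      intro s
      have := hT (W n) (W (n + 1)) D _ (hW n).1 (hW (n + 1)).1 (hW n).2 (hW (n + 1)).2 ih s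
      rw [← W_succ, ← W_succ] at this
      rw [pow_succ]
      linarith
  have hdist : ∀ s n, dist (W n s) (W (n + 1) s) ≤ B * b ^ n := fun s n => hstep n s
  have hcau : ∀ s, ∃ l, Filter.Tendsto (fun n => W n s) Filter.atTop (nhds l) := fun s =>
    cauchySeq_tendsto_of_complete (cauchySeq_of_le_geometric b B hb1 (hdist s))
  choose V hV using hcau
  have hVm : Measurable V :=
    measurable_of_tendsto_metrizable (fun n => (hW n).1) (tendsto_pi_nhds.2 hV)
  have hVD : ∀ s, |V s| ≤ D := fun s => le_of_tendsto' (hV s).abs fun n => (hW n).2 s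
  have hVW : ∀ n s, |V s - W n s| ≤ B * b ^ n / (1 - b) := by
    intro n s
    have := dist_le_of_le_geometric_of_tendsto b B hb1 (hdist s) (hV s) n
    rwa [dist_comm, Real.dist_eq] at this
  refine ⟨V, hVm, hVD, fun s => ?_⟩
  have hlim : Filter.Tendsto (fun n => T (W n) s) Filter.atTop (nhds (T V s)) := by
    rw [tendsto_iff_dist_tendsto_zero]
    have h0 : Filter.Tendsto (fun n : ℕ => b * (B * b ^ n / (1 - b))) Filter.atTop (nhds 0) := by
      have := (tendsto_pow_atTop_nhds_zero_of_lt_one hb0 hb1).const_mul (b * B / (1 - b))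
      rw [mul_zero] at this
      refine this.congr fun n => ?_
      ring
    refine squeeze_zero (fun _ => dist_nonneg) (fun n => ?_) h0
    rw [dist_comm]
    exact hT V (W n) D _ hVm (hW n).1 hVD (hW n).2 (hVW n) s
  refine tendsto_nhds_unique hlim ?_
  simp_rw [← W_succ]
  exact (Filter.tendsto_add_atTop_iff_nat 1).2 (hV s)

theorem measurable_snoc {A : Type*} [MeasurableSpace A] (n : ℕ) :
    Measurable fun p : (Fin n → A) × A => (Fin.snoc p.1 p.2 : Fin (n + 1) → A) := by
  refine measurable_pi_iff.2 fun i => ?_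
  induction i using Fin.lastCases with
  | last => simpa using measurable_snd
  | cast i =>
    simp only [Fin.snoc_castSucc]
    exact (measurable_pi_apply i).comp measurable_fst

/-! ### Bounded discounted decision processes: Bellman equations and near-optimal policies. -/

section MDP

variable {ι : Type*} {U Y : ι → Type*} [∀ i, MeasurableSpace (U i)] [∀ i, MeasurableSpace (Y i)]
  {K : ℕ} {S : Type*} [MeasurableSpace S]

/-- The rule that always chooses the map-valued action `a`. -/
def Rule.const {Ω : Type*} [MeasurableSpace Ω] (a : BlockAction U Y K) : Rule U Y K Ω where
  act _ := a
  measurable_act r i := (a.measurable_map r i).comp measurable_snd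

/-- A decision process with a measurable transition kernel and a measurable cost bounded
by `B`. -/
structure IsBoundedMDP (θ : S → BlockAction U Y K → Measure S) (r : S → BlockAction U Y K → ℝ)
    (B : ℝ) : Prop where
  prob : ∀ s a, IsProbabilityMeasure (θ s a)
  measurable_trans_history : ∀ (q : ℕ) (γ : Rule U Y K (Fin (q + 1) → S)),
    Measurable fun p => θ (p (Fin.last q)) (γ.act p)
  measurable_cost_history : ∀ (q : ℕ) (γ : Rule U Y K (Fin (q + 1) → S)),
    Measurable fun p => r (p (Fin.last q)) (γ.act p)
  abs_cost_le : ∀ s a, |r s a| ≤ B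

/-- The cost of the action `a` in state `s` when the cost-to-go is `V`. -/
def bellman (θ : S → BlockAction U Y K → Measure S) (r : S → BlockAction U Y K → ℝ) (b : ℝ)
    (V : S → ℝ) (s : S) (a : BlockAction U Y K) : ℝ :=
  r s a + b * ∫ s', V s' ∂(θ s a)

namespace IsBoundedMDP

variable {θ : S → BlockAction U Y K → Measure S} {r : S → BlockAction U Y K → ℝ} {B b : ℝ}

/-- Map-valued actions have no σ-algebra, so measurability is only available along rules. A rule on
`S` is treated as a rule on histories of length one. -/
theorem measurable_trans (h : IsBoundedMDP θ r B) (γ : Rule U Y K S) :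
    Measurable fun s => θ s (γ.act s) :=
  (h.measurable_trans_history 0 (γ.comap _ (measurable_pi_apply 0))).comp
    (measurable_pi_lambda (fun s _ => s) fun _ => measurable_id)

theorem measurable_cost (h : IsBoundedMDP θ r B) (γ : Rule U Y K S) :
    Measurable fun s => r s (γ.act s) :=
  (h.measurable_cost_history 0 (γ.comap _ (measurable_pi_apply 0))).comp
    (measurable_pi_lambda (fun s _ => s) fun _ => measurable_id)

theorem measurable_integral_trans (h : IsBoundedMDP θ r B) (γ : Rule U Y K S) {V : S → ℝ}
    (hV : Measurable V) : Measurable fun s => ∫ s', V s' ∂(θ s (γ.act s)) :=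
  measurable_integral_param (f := fun p => V p.2) (h.measurable_trans γ) (fun _ => h.prob _ _)
    (hV.comp measurable_snd)

theorem measurable_bellman (h : IsBoundedMDP θ r B) (γ : Rule U Y K S) {V : S → ℝ}
    (hV : Measurable V) : Measurable fun s => bellman θ r b V s (γ.act s) :=
  (h.measurable_cost γ).add ((h.measurable_integral_trans γ hV).const_mul b)

theorem abs_integral_trans_le (h : IsBoundedMDP θ r B) {V : S → ℝ} {D : ℝ}
    (hV : ∀ s, |V s| ≤ D) (s : S) (a : BlockAction U Y K) : |∫ s', V s' ∂(θ s a)| ≤ D := by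
  have := h.prob s a
  exact abs_integral_le_of_abs_le hV

theorem abs_bellman_le (h : IsBoundedMDP θ r B) (hb0 : 0 ≤ b) {V : S → ℝ} {D : ℝ}
    (hV : ∀ s, |V s| ≤ D) (s : S) (a : BlockAction U Y K) :
    |bellman θ r b V s a| ≤ B + b * D := by
  refine (abs_add_le _ _).trans (add_le_add (h.abs_cost_le s a) ?_)
  rw [abs_mul, abs_of_nonneg hb0]
  exact mul_le_mul_of_nonneg_left (h.abs_integral_trans_le hV s a) hb0

theorem abs_bellman_sub_le (h : IsBoundedMDP θ r B) (hb0 : 0 ≤ b) {V W : S → ℝ} {D δ : ℝ}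
    (hVm : Measurable V) (hWm : Measurable W) (hV : ∀ s, |V s| ≤ D) (hW : ∀ s, |W s| ≤ D)
    (hVW : ∀ s, |V s - W s| ≤ δ) (s : S) (a : BlockAction U Y K) :
    |bellman θ r b V s a - bellman θ r b W s a| ≤ b * δ := by
  have := h.prob s a
  have heq : bellman θ r b V s a - bellman θ r b W s a = b * ∫ s', (V s' - W s') ∂(θ s a) := by
    rw [integral_sub (integrable_of_abs_le hVm hV) (integrable_of_abs_le hWm hW)]
    simp only [bellman]
    ring
  rw [heq, abs_mul, abs_of_nonneg hb0]
  exact mul_le_mul_of_nonneg_left (abs_integral_le_of_abs_le hVW) hb0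

theorem measurable_stateLaw_step (h : IsBoundedMDP θ r B) (γ : Policy U Y K S) (q : ℕ) :
    Measurable fun s : Fin (q + 1) → S => (θ (s (Fin.last q)) ((γ q).act s)).map fun s' =>
      (Fin.snoc s s' : Fin (q + 1 + 1) → S) :=
  measurable_map_param (g := fun p : (Fin (q + 1) → S) × S =>
    (Fin.snoc p.1 p.2 : Fin (q + 1 + 1) → S)) (h.measurable_trans_history q (γ q))
    (fun _ => h.prob _ _) (measurable_snoc _)

theorem measurable_snoc_right (q : ℕ) (s : Fin q → S) :
    Measurable fun s' => (Fin.snoc s s' : Fin (q + 1) → S) :=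
  (measurable_snoc q).comp measurable_prodMk_left

theorem isProbabilityMeasure_stateLaw_step (h : IsBoundedMDP θ r B) (γ : Policy U Y K S) (q : ℕ)
    (s : Fin (q + 1) → S) : IsProbabilityMeasure ((θ (s (Fin.last q)) ((γ q).act s)).map fun s' =>
      (Fin.snoc s s' : Fin (q + 1 + 1) → S)) := by
  have := h.prob (s (Fin.last q)) ((γ q).act s)
  exact Measure.isProbabilityMeasure_map (measurable_snoc_right _ s).aemeasurable

theorem isProbabilityMeasure_stateLaw (h : IsBoundedMDP θ r B) (γ : Policy U Y K S)
    (ν : Measure S) [IsProbabilityMeasure ν] (q : ℕ) :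
    IsProbabilityMeasure (stateLaw θ γ ν q) := by
  induction q with
  | zero =>
    exact Measure.isProbabilityMeasure_map
      (measurable_pi_lambda (fun s _ => s) fun _ => measurable_id).aemeasurable
  | succ q ih =>
    exact isProbabilityMeasure_bind_of_measurable (h.measurable_stateLaw_step γ q)
      (h.isProbabilityMeasure_stateLaw_step γ q)

theorem integral_stateLaw_zero (γ : Policy U Y K S) (ν : Measure S) {V : S → ℝ}
    (hV : Measurable V) : ∫ p, V (p (Fin.last 0)) ∂(stateLaw θ γ ν 0) = ∫ s, V s ∂ν := by
  have hm : Measurable fun p : Fin (0 + 1) → S => V (p (Fin.last 0)) :=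
    hV.comp (measurable_pi_apply _)
  simp only [stateLaw]
  rw [integral_map (measurable_pi_lambda (fun s _ => s) fun _ => measurable_id).aemeasurable
    hm.aestronglyMeasurable]

/-- The tower property: condition on the history up to period `q`. -/
theorem integral_stateLaw_succ (h : IsBoundedMDP θ r B) (γ : Policy U Y K S) (ν : Measure S)
    [IsProbabilityMeasure ν] {V : S → ℝ} {D : ℝ} (hVm : Measurable V) (hV : ∀ s, |V s| ≤ D)
    (q : ℕ) :
    ∫ p, V (p (Fin.last (q + 1))) ∂(stateLaw θ γ ν (q + 1)) =
      ∫ p, ∫ s', V s' ∂(θ (p (Fin.last q)) ((γ q).act p)) ∂(stateLaw θ γ ν q) := by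
  have := h.isProbabilityMeasure_stateLaw γ ν q
  have hm : Measurable fun p : Fin (q + 1 + 1) → S => V (p (Fin.last (q + 1))) :=
    hVm.comp (measurable_pi_apply _)
  simp only [stateLaw]
  rw [integral_bind_of_abs_le (h.measurable_stateLaw_step γ q)
    (h.isProbabilityMeasure_stateLaw_step γ q) hm (fun p => hV _)]
  refine integral_congr_ae (Filter.Eventually.of_forall fun p => ?_)
  simp only
  rw [integral_map (measurable_snoc_right _ p).aemeasurable hm.aestronglyMeasurable]
  simp

theorem measurable_integral_history (h : IsBoundedMDP θ r B) (γ : Policy U Y K S) (q : ℕ)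
    {V : S → ℝ} (hV : Measurable V) :
    Measurable fun p : Fin (q + 1) → S => ∫ s', V s' ∂(θ (p (Fin.last q)) ((γ q).act p)) :=
  measurable_integral_param (f := fun p => V p.2) (h.measurable_trans_history q (γ q))
    (fun _ => h.prob _ _) (hV.comp measurable_snd)

theorem abs_integral_stateLaw_le (h : IsBoundedMDP θ r B) (γ : Policy U Y K S) (ν : Measure S)
    [IsProbabilityMeasure ν] {q : ℕ} {f : (Fin (q + 1) → S) → ℝ} {D : ℝ} (hf : ∀ p, |f p| ≤ D) :
    |∫ p, f p ∂(stateLaw θ γ ν q)| ≤ D := by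
  have := h.isProbabilityMeasure_stateLaw γ ν q
  exact abs_integral_le_of_abs_le hf

theorem integrable_stateLaw (h : IsBoundedMDP θ r B) (γ : Policy U Y K S) (ν : Measure S)
    [IsProbabilityMeasure ν] {q : ℕ} {f : (Fin (q + 1) → S) → ℝ} {D : ℝ} (hfm : Measurable f)
    (hf : ∀ p, |f p| ≤ D) : Integrable f (stateLaw θ γ ν q) := by
  have := h.isProbabilityMeasure_stateLaw γ ν q
  exact integrable_of_abs_le hfm hf

theorem integral_history_add_mul (h : IsBoundedMDP θ r B) (γ : Policy U Y K S) (ν : Measure S)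
    [IsProbabilityMeasure ν] {V : S → ℝ} {D C : ℝ} (hVm : Measurable V) (hV : ∀ s, |V s| ≤ D)
    {q : ℕ} {f : (Fin (q + 1) → S) → ℝ} (hfm : Measurable f) (hf : ∀ p, |f p| ≤ C) :
    ∫ p, (f p + b * ∫ s', V s' ∂(θ (p (Fin.last q)) ((γ q).act p))) ∂(stateLaw θ γ ν q) =
      ∫ p, f p ∂(stateLaw θ γ ν q) +
        b * ∫ p, V (p (Fin.last (q + 1))) ∂(stateLaw θ γ ν (q + 1)) := by
  rw [h.integral_stateLaw_succ γ ν hVm hV, integral_add (h.integrable_stateLaw γ ν hfm hf)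
    ((h.integrable_stateLaw γ ν (h.measurable_integral_history γ q hVm)
      (fun p => h.abs_integral_trans_le hV _ _)).const_mul b), integral_const_mul]

theorem integral_history_le_integral_add (h : IsBoundedMDP θ r B) (hb0 : 0 ≤ b)
    (γ : Policy U Y K S) (ν : Measure S)
    [IsProbabilityMeasure ν] {V : S → ℝ} {D C : ℝ} (hVm : Measurable V) (hV : ∀ s, |V s| ≤ D)
    {q : ℕ} {f : (Fin (q + 1) → S) → ℝ} (hfm : Measurable f) (hf : ∀ p, |f p| ≤ C)
    (hle : ∀ p : Fin (q + 1) → S, V (p (Fin.last q)) ≤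
      f p + b * ∫ s', V s' ∂(θ (p (Fin.last q)) ((γ q).act p))) :
    ∫ p, V (p (Fin.last q)) ∂(stateLaw θ γ ν q) ≤ ∫ p, f p ∂(stateLaw θ γ ν q) +
        b * ∫ p, V (p (Fin.last (q + 1))) ∂(stateLaw θ γ ν (q + 1)) := by
  rw [← h.integral_history_add_mul γ ν hVm hV hfm hf]
  refine integral_mono (h.integrable_stateLaw γ ν (hVm.comp (measurable_pi_apply _))
    fun p => hV _) (h.integrable_stateLaw γ ν (D := C + b * D) (hfm.add
      ((h.measurable_integral_history γ q hVm).const_mul b)) fun p => ?_) hle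
  refine (abs_add_le _ _).trans (add_le_add (hf p) ?_)
  rw [abs_mul, abs_of_nonneg hb0]
  exact mul_le_mul_of_nonneg_left (h.abs_integral_trans_le hV _ _) hb0

/-- A bounded function which decreases at most by `f q` along the process is bounded by the total
discounted decrease. -/
theorem integral_le_tsum (h : IsBoundedMDP θ r B) (hb0 : 0 ≤ b) (hb1 : b < 1)
    (γ : Policy U Y K S) (ν : Measure S)
    [IsProbabilityMeasure ν] {V : S → ℝ} {D C : ℝ} (hVm : Measurable V) (hV : ∀ s, |V s| ≤ D)
    {f : ∀ q, (Fin (q + 1) → S) → ℝ} (hfm : ∀ q, Measurable (f q)) (hf : ∀ q p, |f q p| ≤ C)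
    (hle : ∀ q, ∀ p : Fin (q + 1) → S, V (p (Fin.last q)) ≤
      f q p + b * ∫ s', V s' ∂(θ (p (Fin.last q)) ((γ q).act p))) :
    ∫ s, V s ∂ν ≤ ∑' q, b ^ q * ∫ p, f q p ∂(stateLaw θ γ ν q) := by
  rw [← integral_stateLaw_zero (θ := θ) γ ν hVm]
  exact le_tsum_of_le_add_mul hb0 hb1
    (v := fun q => ∫ p, V (p (Fin.last q)) ∂(stateLaw θ γ ν q))
    (fun q => h.abs_integral_stateLaw_le γ ν fun p => hV _)
    (summable_geometric_mul hb0 hb1 fun q => h.abs_integral_stateLaw_le γ ν (hf q))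
    fun q => h.integral_history_le_integral_add hb0 γ ν hVm hV (hfm q) (hf q) (hle q)

/-- Verification from below: the Bellman inequality along the policy lets `V` drop by at most the
stage cost in each period. -/
theorem le_policyCost (h : IsBoundedMDP θ r B) (hb0 : 0 ≤ b) (hb1 : b < 1)
    (γ : Policy U Y K S) {V : S → ℝ} {D : ℝ} (hVm : Measurable V) (hV : ∀ s, |V s| ≤ D)
    (hle : ∀ q, ∀ p : Fin (q + 1) → S, V (p (Fin.last q)) ≤
      bellman θ r b V (p (Fin.last q)) ((γ q).act p)) (s : S) :
    V s ≤ policyCost θ r b γ s := by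
  have := h.integral_le_tsum hb0 hb1 γ (Measure.dirac s) hVm hV
    (f := fun q p => r (p (Fin.last q)) ((γ q).act p))
    (fun q => h.measurable_cost_history q (γ q)) (fun q p => h.abs_cost_le _ _) hle
  rwa [integral_dirac' _ _ hVm.stronglyMeasurable] at this

/-- Verification from above: the drop estimate is applied to `-V`, with allowance `ε` minus the
stage cost. The discounted sum of the `ε`'s is `ε / (1 - b)`. -/
theorem policyCost_le_add (h : IsBoundedMDP θ r B) (hb0 : 0 ≤ b) (hb1 : b < 1)
    (γ : Policy U Y K S) {V : S → ℝ} {D : ℝ} (hVm : Measurable V) (hV : ∀ s, |V s| ≤ D) {ε : ℝ}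
    (hle : ∀ q, ∀ p : Fin (q + 1) → S,
      bellman θ r b V (p (Fin.last q)) ((γ q).act p) ≤ V (p (Fin.last q)) + ε) (s : S) :
    policyCost θ r b γ s ≤ V s + ε / (1 - b) := by
  have h1b : 0 < 1 - b := by linarith
  have hf : ∀ q (p : Fin (q + 1) → S), |ε - r (p (Fin.last q)) ((γ q).act p)| ≤ |ε| + B :=
    fun q p => (abs_sub _ _).trans (add_le_add le_rfl (h.abs_cost_le _ _))
  have := h.integral_le_tsum hb0 hb1 γ (Measure.dirac s) hVm.neg (D := D)
    (fun s => by simpa using hV s) (f := fun q p => ε - r (p (Fin.last q)) ((γ q).act p))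
    (fun q => (h.measurable_cost_history q (γ q)).const_sub ε) hf (fun q p => by
      have h1 := hle q p
      simp only [bellman] at h1
      simp only [Pi.neg_apply, integral_neg]
      linarith)
  rw [integral_dirac' _ _ hVm.neg.stronglyMeasurable] at this
  have hsplit : ∀ q, ∫ p, (ε - r (p (Fin.last q)) ((γ q).act p))
      ∂(stateLaw θ γ (Measure.dirac s) q) =
      ε - ∫ p, r (p (Fin.last q)) ((γ q).act p) ∂(stateLaw θ γ (Measure.dirac s) q) := by
    intro q
    have := h.isProbabilityMeasure_stateLaw γ (Measure.dirac s) q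
    rw [integral_sub (integrable_const _) (h.integrable_stateLaw γ _
      (h.measurable_cost_history q (γ q)) fun p => h.abs_cost_le _ _)]
    simp
  have hs1 : Summable fun q : ℕ => b ^ q * ε :=
    (summable_geometric_of_lt_one hb0 hb1).mul_right ε
  have hs2 := summable_geometric_mul hb0 hb1 fun q => h.abs_integral_stateLaw_le γ
    (Measure.dirac s) (q := q) fun p => h.abs_cost_le (p (Fin.last q)) ((γ q).act p)
  simp_rw [hsplit, mul_sub] at this
  rw [hs1.tsum_sub hs2, tsum_mul_right, tsum_geometric_of_lt_one hb0 hb1, Pi.neg_apply] at this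
  rw [div_eq_inv_mul]
  unfold policyCost
  linarith

/-- The cost of a stationary Markov policy is a bounded measurable solution of its Bellman
equation. -/
theorem policyCost_stationary (h : IsBoundedMDP θ r B) (hb0 : 0 ≤ b) (hb1 : b < 1)
    (γ : Rule U Y K S) :
    Measurable (policyCost θ r b (stationary γ)) ∧
      (∀ s, |policyCost θ r b (stationary γ) s| ≤ B / (1 - b)) ∧
      ∀ s, bellman θ r b (policyCost θ r b (stationary γ)) s (γ.act s) =
        policyCost θ r b (stationary γ) s := by
  -- The fixed point is constructed first and then identified with the cost by verification on both
  -- sides, so its measurability, bound and equation carry over.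
  obtain ⟨V, hVm, hV, hfix⟩ := exists_measurable_fixedPoint (B := B) hb0 hb1
    (fun V s => bellman θ r b V s (γ.act s)) (fun V D hV _ => h.measurable_bellman γ hV)
    (fun V D _ hV s => h.abs_bellman_le hb0 hV s _)
    (fun V W D δ hVm hWm hV hW hVW s => h.abs_bellman_sub_le hb0 hVm hWm hV hW hVW s _)
  have heq : policyCost θ r b (stationary γ) = V := by
    funext s
    refine le_antisymm ?_ (h.le_policyCost hb0 hb1 _ hVm hV (fun q p => (hfix _).ge) s)
    have := h.policyCost_le_add hb0 hb1 (stationary γ) hVm hV (ε := 0)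
      (fun q p => by rw [add_zero]; exact (hfix _).le) s
    simpa using this
  rw [heq]
  exact ⟨hVm, hV, hfix⟩

/-- The value of an optimal stationary Markov policy satisfies the Bellman inequality. -/
theorem le_bellman_of_isOptimal (h : IsBoundedMDP θ r B) (hb0 : 0 ≤ b) (hb1 : b < 1)
    {γ : Rule U Y K S} (hγ : IsOptimal θ r b γ) (s : S) (a : BlockAction U Y K) :
    policyCost θ r b (stationary γ) s ≤ bellman θ r b (policyCost θ r b (stationary γ)) s a := by
  obtain ⟨hVm, hV, hfix⟩ := h.policyCost_stationary hb0 hb1 γ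
  set V := policyCost θ r b (stationary γ)
  -- One-shot deviation: play `a` in period `0` and return to `γ` afterwards. Optimality against
  -- this nonstationary policy is the Bellman inequality.
  let γ' : Policy U Y K S := fun q => if q = 0 then Rule.const a else stationary γ q
  refine (hγ s γ').trans ?_
  have hbound := fun q => h.abs_integral_stateLaw_le γ' (Measure.dirac s) (q := q)
    fun p => h.abs_cost_le (p (Fin.last q)) ((γ' q).act p)
  -- From period `1` on, the policy is `γ`, whose cost solves its Bellman equation; hence the tail
  -- costs at most the mean of `V` at that period.
  have htail := tsum_le_of_add_mul_le hb0 hb1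
    (v := fun q => ∫ p, V (p (Fin.last (q + 1))) ∂(stateLaw θ γ' (Measure.dirac s) (q + 1)))
    (g := fun q => ∫ p, r (p (Fin.last (q + 1))) ((γ' (q + 1)).act p)
      ∂(stateLaw θ γ' (Measure.dirac s) (q + 1)))
    (fun q => h.abs_integral_stateLaw_le γ' _ fun p => hV _)
    (summable_geometric_mul hb0 hb1 fun q => hbound (q + 1)) (fun q => by
      rw [← h.integral_history_add_mul γ' _ hVm hV (h.measurable_cost_history (q + 1) _)
        (fun p => h.abs_cost_le _ _)]
      refine (integral_congr_ae (Filter.Eventually.of_forall fun p => ?_)).le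
      exact hfix (p (Fin.last (q + 1))))
  have hV1 : ∫ p, V (p (Fin.last 1)) ∂(stateLaw θ γ' (Measure.dirac s) 1) =
      ∫ s', V s' ∂(θ s a) := by
    have hm := h.measurable_integral_trans (Rule.const a) hVm
    exact (h.integral_stateLaw_succ γ' _ hVm hV 0).trans
      ((integral_stateLaw_zero (θ := θ) γ' (Measure.dirac s) (V := fun s => ∫ s', V s' ∂(θ s a))
        hm).trans (integral_dirac' _ _ hm.stronglyMeasurable))
  have hr0 : ∫ p, r (p (Fin.last 0)) ((γ' 0).act p) ∂(stateLaw θ γ' (Measure.dirac s) 0) =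
      r s a := by
    have hm := h.measurable_cost (Rule.const a)
    exact (integral_stateLaw_zero (θ := θ) γ' (Measure.dirac s) (V := fun s => r s a) hm).trans
      (integral_dirac' _ _ hm.stronglyMeasurable)
  replace htail := htail.trans_eq hV1
  unfold policyCost bellman
  rw [(summable_geometric_mul hb0 hb1 hbound).tsum_eq_zero_add, pow_zero, one_mul, hr0]
  refine add_le_add le_rfl ?_
  simp_rw [pow_succ', mul_assoc]
  rw [tsum_mul_left]
  exact mul_le_mul_of_nonneg_left htail hb0

/-- If countably many actions are as good as all actions, then the optimal value function is
measurable and nearly attained by stationary Markov policies. -/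
theorem optimalCost_of_dense (h : IsBoundedMDP θ r B) (hb0 : 0 ≤ b) (hb1 : b < 1)
    (act : ℕ → BlockAction U Y K)
    (hact : ∀ V : S → ℝ, ∀ D, Measurable V → (∀ s, |V s| ≤ D) → ∀ s a, ∀ ε > 0,
      ∃ n, bellman θ r b V s (act n) ≤ bellman θ r b V s a + ε) :
    Measurable (optimalCost θ r b) ∧ (∀ s, |optimalCost θ r b s| ≤ B / (1 - b)) ∧
      ∀ ε > 0, ∃ γ : Rule U Y K S, ∀ s,
        bellman θ r b (optimalCost θ r b) s (γ.act s) ≤ optimalCost θ r b s + ε := by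
  classical
  have hbdd : ∀ {V : S → ℝ} {D : ℝ}, (∀ s, |V s| ≤ D) → ∀ s,
      BddBelow (Set.range fun n => bellman θ r b V s (act n)) := by
    intro V D hV s
    refine ⟨-(B + b * D), ?_⟩
    rintro _ ⟨n, rfl⟩
    exact (abs_le.1 (h.abs_bellman_le hb0 hV s _)).1
  -- The infimum runs over the sequence only, which keeps the operator within the measurable
  -- functions.
  obtain ⟨V, hVm, hV, hfix⟩ := exists_measurable_fixedPoint (B := B) hb0 hb1
    (fun V s => ⨅ n, bellman θ r b V s (act n))
    (fun V D hV _ => Measurable.iInf fun n => h.measurable_bellman (Rule.const (act n)) hV)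
    (fun V D _ hV s => abs_le.2 ⟨le_ciInf fun n => (abs_le.1 (h.abs_bellman_le hb0 hV s _)).1,
      (ciInf_le (hbdd hV s) 0).trans (abs_le.1 (h.abs_bellman_le hb0 hV s _)).2⟩)
    (fun V W D δ hVm hWm hV hW hVW s => by
      have hd := fun n => abs_le.1 (h.abs_bellman_sub_le hb0 hVm hWm hV hW hVW s (act n))
      refine abs_sub_le_iff.2 ⟨?_, ?_⟩
      · rw [sub_le_iff_le_add, ← sub_le_iff_le_add']
        exact le_ciInf fun n => by linarith [ciInf_le (hbdd hV s) n, (hd n).2]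
      · rw [sub_le_iff_le_add, ← sub_le_iff_le_add']
        exact le_ciInf fun n => by linarith [ciInf_le (hbdd hW s) n, (hd n).1])
  have hVa : ∀ s a, V s ≤ bellman θ r b V s a := by
    intro s a
    refine le_of_forall_pos_le_add fun ε hε => ?_
    obtain ⟨n, hn⟩ := hact V _ hVm hV s a ε hε
    rw [← hfix s]
    exact (ciInf_le (hbdd hV s) n).trans hn
  have hgreedy : ∀ ε > 0, ∃ γ : Rule U Y K S, ∀ s, bellman θ r b V s (γ.act s) ≤ V s + ε := by
    intro ε hε
    have hex : ∀ s, ∃ n, bellman θ r b V s (act n) ≤ V s + ε := by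
      intro s
      obtain ⟨n, hn⟩ := exists_lt_of_ciInf_lt (f := fun n => bellman θ r b V s (act n))
        (a := V s + ε) (by rw [hfix s]; linarith)
      exact ⟨n, hn.le⟩
    -- Taking the least `ε`-optimal index gives a measurable selection.
    have hN : Measurable fun s => Nat.find (hex s) := measurable_find hex fun n =>
      measurableSet_le (h.measurable_bellman (Rule.const (act n)) hVm) (hVm.add_const ε)
    refine ⟨⟨fun s => act (Nat.find (hex s)), fun k i => ?_⟩, fun s => Nat.find_spec (hex s)⟩
    have hu : Measurable fun p : ℕ × ((Fin (k + 1) → Y i) × (Fin k → U i)) =>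
        (act p.1).map k i p.2.1 p.2.2 :=
      measurable_from_prod_countable_right fun n => (act n).measurable_map k i
    exact hu.comp ((hN.comp measurable_fst).prodMk measurable_snd)
  have hle : ∀ s (γ : Policy U Y K S), V s ≤ policyCost θ r b γ s := fun s γ =>
    h.le_policyCost hb0 hb1 γ hVm hV (fun q p => hVa _ _) s
  have heq : optimalCost θ r b = V := by
    funext s
    have : Nonempty (Policy U Y K S) := ⟨fun _ => Rule.const (act 0)⟩
    refine le_antisymm (le_of_forall_pos_le_add fun ε hε => ?_) (le_ciInf fun γ => hle s γ)
    -- A slack of `ε * (1 - b)` per period accumulates to `ε`.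
    obtain ⟨γ, hγ⟩ := hgreedy (ε * (1 - b)) (mul_pos hε (by linarith))
    have := h.policyCost_le_add hb0 hb1 (stationary γ) hVm hV (fun q p => hγ _) s
    rw [mul_div_cancel_right₀ _ (by linarith : (1 - b) ≠ 0)] at this
    refine (ciInf_le ⟨V s, ?_⟩ (stationary γ)).trans this
    rintro _ ⟨γ', rfl⟩
    exact hle s γ'
  rw [heq]
  exact ⟨hVm, hV, hgreedy⟩

end IsBoundedMDP

end MDP

theorem measurable_foldl {Ω P : Type*} [MeasurableSpace Ω] [MeasurableSpace P] {n : ℕ}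
    {f : Ω → P → Fin n → P} (hf : ∀ i, Measurable fun p : Ω × P => f p.1 p.2 i) {z : Ω → P}
    (hz : Measurable z) : Measurable fun ω => Fin.foldl n (f ω) (z ω) := by
  induction n with
  | zero => simpa using hz
  | succ n ih =>
    simp_rw [Fin.foldl_succ_last]
    exact (hf (Fin.last n)).comp
      (measurable_id.prodMk (ih (f := fun ω p i => f ω p i.castSucc) fun i => hf _))

/-! ### Measurability of the predictors and of the law of one period. -/

section Model

variable {ι : Type*} [Fintype ι] {X : Type*} [MeasurableSpace X] {U Y : ι → Type*}
  [∀ i, MeasurableSpace (U i)] [∀ i, MeasurableSpace (Y i)]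

namespace Model

variable (m : Model X U Y) {K M : ℕ} {Ω : Type*} [MeasurableSpace Ω]

instance isMarkovKernel_T : IsMarkovKernel m.T := m.markov_T

instance isProbabilityMeasure_ψ (i : ι) : IsProbabilityMeasure (m.ψ i) := m.prob_ψ i

instance isProbabilityMeasure_withDensity_h (i : ι) (x : X) :
    IsProbabilityMeasure ((m.ψ i).withDensity fun y => (m.h i x y : ℝ≥0∞)) :=
  ⟨by rw [withDensity_apply _ MeasurableSet.univ, Measure.restrict_univ, m.lintegral_h]⟩

instance isProbabilityMeasure_channel (x : X) : IsProbabilityMeasure (m.channel x) := by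
  unfold channel
  infer_instance

/-- It suffices to test on measurable boxes, where the product measure is a finite product of
integrals of the likelihoods. -/
theorem measurable_channel : Measurable m.channel := by
  refine Measurable.measure_of_isPiSystem_of_isProbabilityMeasure generateFrom_pi.symm
    isPiSystem_pi ?_
  rintro _ ⟨s, hs, rfl⟩
  have hs' : ∀ i, MeasurableSet (s i) := fun i => hs i (Set.mem_univ i)
  simp_rw [channel, Measure.pi_pi]
  refine Finset.measurable_prod _ fun i _ => ?_
  simp_rw [withDensity_apply _ (hs' i)]
  exact Measurable.lintegral_prod_right' (ν := (m.ψ i).restrict (s i))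
    (f := fun p : X × Y i => (m.h i p.1 p.2 : ℝ≥0∞)) (m.measurable_h i).coe_nnreal_ennreal

theorem measurable_likelihood :
    Measurable fun p : (∀ i, Y i) × X => m.likelihood p.1 p.2 := by
  unfold likelihood
  refine Finset.measurable_prod _ fun i _ => Measurable.coe_nnreal_ennreal ?_
  exact (m.measurable_h i).comp
    (measurable_snd.prodMk ((measurable_pi_apply i).comp measurable_fst))

theorem measurable_filter {Z : Ω → Measure X} (hZ : Measurable Z)
    (hZ' : ∀ ω, IsProbabilityMeasure (Z ω)) {y : Ω → ∀ i, Y i} (hy : Measurable y) :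
    Measurable fun ω => m.filter (Z ω) (y ω) := by
  have hl : Measurable fun p : Ω × X => m.likelihood (y p.1) p.2 :=
    m.measurable_likelihood.comp ((hy.comp measurable_fst).prodMk measurable_snd)
  have hc : Measurable fun ω => ∫⁻ x, m.likelihood (y ω) x ∂(Z ω) :=
    measurable_lintegral_param hZ hZ' hl
  unfold filter
  refine Measurable.ite ((hc (measurableSet_singleton 0)).union
    (hc (measurableSet_singleton ∞))) hZ ?_
  refine Measure.measurable_of_measurable_coe _ fun s hs => ?_
  simp only [Measure.smul_apply, smul_eq_mul]
  refine hc.inv.mul ?_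
  simp_rw [withDensity_apply _ hs, ← lintegral_indicator hs]
  exact measurable_lintegral_param
    (f := fun p : Ω × X => s.indicator (fun x => m.likelihood (y p.1) x) p.2) hZ hZ'
    (hl.indicator (measurable_snd hs))

theorem measurable_update :
    Measurable fun p : ProbabilityMeasure X × ((∀ i, Y i) × (∀ i, U i)) => m.update p.1 p.2 := by
  refine Measurable.subtype_mk ?_
  have hf := m.measurable_filter (Ω := ProbabilityMeasure X × ((∀ i, Y i) × (∀ i, U i)))
    (Z := fun p => (p.1 : Measure X)) (measurable_subtype_coe.comp measurable_fst)
    (fun _ => inferInstance) (y := fun p => p.2.1) (measurable_fst.comp measurable_snd)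
  exact measurable_bind_param
    (κ := fun q : (ProbabilityMeasure X × ((∀ i, Y i) × (∀ i, U i))) × X => m.T (q.2, q.1.2.2)) hf
    (fun p => m.isProbabilityMeasure_filter _ _)
    (m.T.measurable.comp (measurable_snd.prodMk
      (measurable_snd.comp (measurable_snd.comp measurable_fst))))

theorem measurable_blockUpdate :
    Measurable fun p : ProbabilityMeasure X × Block U Y K => m.blockUpdate p.1 p.2 := by
  have hg : ∀ r : Fin K, Measurable
      fun p : (ProbabilityMeasure X × Block U Y K) × ProbabilityMeasure X =>
        m.update p.2 (p.1.2 r) := by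
    intro r
    have hf : Measurable fun p : (ProbabilityMeasure X × Block U Y K) × ProbabilityMeasure X =>
        (p.2, p.1.2 r) :=
      measurable_snd.prodMk ((measurable_pi_apply r).comp (measurable_snd.comp measurable_fst))
    have h := m.measurable_update.comp hf
    exact h
  have h := measurable_foldl (z := Prod.fst)
    (f := fun (p : ProbabilityMeasure X × Block U Y K) Z' r => m.update Z' (p.2 r)) hg
    measurable_fst
  exact h

theorem measurable_predictor :
    Measurable (m.predictor : State X U Y K M → ProbabilityMeasure X) := by
  have hg : ∀ j : Fin M, Measurable fun p : State X U Y K M × ProbabilityMeasure X =>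
      m.blockUpdate p.2 (p.1.2 j) := by
    intro j
    have hf : Measurable fun p : State X U Y K M × ProbabilityMeasure X => (p.2, p.1.2 j) :=
      measurable_snd.prodMk ((measurable_pi_apply j).comp (measurable_snd.comp measurable_fst))
    have h := m.measurable_blockUpdate.comp hf
    exact h
  have h := measurable_foldl (z := Prod.fst)
    (f := fun (s : State X U Y K M) Z j => m.blockUpdate Z (s.2 j)) hg measurable_fst
  exact h

theorem measurable_predictor_measure :
    Measurable fun s : State X U Y K M => (m.predictor s : Measure X) :=
  measurable_subtype_coe.comp m.measurable_predictor

/-- The window after the period `b` has been observed. -/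
def nextWindow (w : Window U Y K M) (b : Block U Y K) : Window U Y K M :=
  Fin.tail (Fin.snoc w b : Fin (M + 1) → Block U Y K)

/-- The new window does not involve the predictor component, so states sharing a window can be
compared along the same path. -/
theorem nextState_snd (s : State X U Y K M) (b : Block U Y K) :
    (m.nextState s b).2 = nextWindow s.2 b := rfl

theorem measurable_nextState :
    Measurable fun p : State X U Y K M × Block U Y K => m.nextState p.1 p.2 := by
  have hw : Measurable fun p : State X U Y K M × Block U Y K =>
      (Fin.snoc p.1.2 p.2 : Fin (M + 1) → Block U Y K) :=
    (measurable_snoc M).comp ((measurable_snd.comp measurable_fst).prodMk measurable_snd)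
  have hj : ∀ j : Fin (M + 1), Measurable fun p : State X U Y K M × Block U Y K =>
      (Fin.snoc p.1.2 p.2 : Fin (M + 1) → Block U Y K) j := fun j => measurable_pi_iff.1 hw j
  have h0 : Measurable fun p : State X U Y K M × Block U Y K =>
      (p.1.1, (Fin.snoc p.1.2 p.2 : Fin (M + 1) → Block U Y K) 0) :=
    (measurable_fst.comp measurable_fst).prodMk (hj 0)
  have h1 := m.measurable_blockUpdate.comp h0
  exact h1.prodMk (measurable_pi_iff.2 fun j : Fin M => hj j.succ)

/-! ### The law of one period -/

/-- The stages `(x_k, y_k, u_k)`, `k < r`, and the state `x_r`. -/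
abbrev Path {ι : Type*} (X : Type*) (U Y : ι → Type*) (r : ℕ) :=
  (Fin r → X × (∀ i, Y i) × (∀ i, U i)) × X

/-- The private information of agent `i` at stage `r`. -/
def privateInfo (r : ℕ) (i : ι) (q : Path X U Y r × (∀ i, Y i)) :
    (Fin (r + 1) → Y i) × (Fin r → U i) :=
  (Fin.snoc (fun k => (q.1.1 k).2.1 i) (q.2 i), fun k => (q.1.1 k).2.2 i)

omit [Fintype ι] in
theorem measurable_privateInfo (r : ℕ) (i : ι) :
    Measurable (privateInfo r i : Path X U Y r × (∀ i, Y i) → _) := by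
  have h : ∀ k : Fin r, Measurable fun q : Path X U Y r × (∀ i, Y i) => q.1.1 k :=
    fun k => (measurable_pi_apply k).comp (measurable_fst.comp measurable_fst)
  have h1 : Measurable fun q : Path X U Y r × (∀ i, Y i) => fun k : Fin r => (q.1.1 k).2.1 i :=
    measurable_pi_lambda _ fun k =>
      (measurable_pi_apply i).comp (measurable_fst.comp (measurable_snd.comp (h k)))
  have h2 : Measurable fun q : Path X U Y r × (∀ i, Y i) => fun k : Fin r => (q.1.1 k).2.2 i :=
    measurable_pi_lambda _ fun k =>
      (measurable_pi_apply i).comp (measurable_snd.comp (measurable_snd.comp (h k)))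
  have h3 : Measurable fun q : Path X U Y r × (∀ i, Y i) => q.2 i :=
    (measurable_pi_apply i).comp measurable_snd
  exact ((measurable_snoc r).comp (h1.prodMk h3)).prodMk h2

/-- The joint action at stage `r`. -/
def jointAction (a : BlockAction U Y K) (r : ℕ) (hr : r < K) (q : Path X U Y r × (∀ i, Y i)) :
    ∀ i, U i :=
  fun i => a.map ⟨r, hr⟩ i (privateInfo r i q).1 (privateInfo r i q).2

omit [Fintype ι] in
theorem measurable_jointAction (γ : Rule U Y K Ω) (r : ℕ) (hr : r < K) :
    Measurable fun p : Ω × (Path X U Y r × (∀ i, Y i)) => jointAction (γ.act p.1) r hr p.2 :=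
  measurable_pi_lambda _ fun i => (γ.measurable_act ⟨r, hr⟩ i).comp
    (measurable_fst.prodMk ((measurable_privateInfo r i).comp measurable_snd))

/-- The path extended by one stage. -/
def extendPath {r : ℕ} (q : Path X U Y r × (∀ i, Y i)) (u : ∀ i, U i) (x' : X) :
    Path X U Y (r + 1) :=
  (Fin.snoc q.1.1 (q.1.2, q.2, u), x')

omit [Fintype ι] in
theorem measurable_extendPath (r : ℕ) :
    Measurable fun p : ((Path X U Y r × (∀ i, Y i)) × (∀ i, U i)) × X =>
      extendPath p.1.1 p.1.2 p.2 := by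
  refine Measurable.prodMk ((measurable_snoc r).comp (Measurable.prodMk ?_ ?_)) measurable_snd
  · fun_prop
  · fun_prop

/-- The conditional law of the extended path, given the measurements. -/
def moveLaw (a : BlockAction U Y K) (r : ℕ) (hr : r < K) (q : Path X U Y r × (∀ i, Y i)) :
    Measure (Path X U Y (r + 1)) :=
  (m.T (q.1.2, jointAction a r hr q)).map (extendPath q (jointAction a r hr q))

omit [Fintype ι] in
theorem measurable_extendPath_right {r : ℕ} (q : Path X U Y r × (∀ i, Y i)) (u : ∀ i, U i) :
    Measurable (extendPath q u) :=
  (measurable_extendPath r).comp (measurable_prodMk_left (x := (q, u)))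

instance isProbabilityMeasure_moveLaw (a : BlockAction U Y K) (r : ℕ) (hr : r < K)
    (q : Path X U Y r × (∀ i, Y i)) : IsProbabilityMeasure (m.moveLaw a r hr q) :=
  Measure.isProbabilityMeasure_map (measurable_extendPath_right q _).aemeasurable

omit [Fintype ι] in
theorem measurable_moveLaw_param (γ : Rule U Y K Ω) (r : ℕ) (hr : r < K) :
    Measurable fun p : Ω × (Path X U Y r × (∀ i, Y i)) => m.moveLaw (γ.act p.1) r hr p.2 := by
  have hu := measurable_jointAction (X := X) γ r hr
  refine measurable_map_param (g := fun p : (Ω × (Path X U Y r × (∀ i, Y i))) × X =>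
    extendPath p.1.2 (jointAction (γ.act p.1.1) r hr p.1.2) p.2)
    (μ := fun p => m.T (p.2.1.2, jointAction (γ.act p.1) r hr p.2))
    (m.T.measurable.comp (Measurable.prodMk (f := fun p => p.2.1.2) (by fun_prop) hu))
    (fun _ => inferInstance) ?_
  exact (measurable_extendPath r).comp
    (Measurable.prodMk (Measurable.prodMk (by fun_prop) (hu.comp measurable_fst)) measurable_snd)

omit [Fintype ι] in
theorem measurable_moveLaw (a : BlockAction U Y K) (r : ℕ) (hr : r < K) :
    Measurable (m.moveLaw a r hr) :=
  (m.measurable_moveLaw_param (Rule.const (Ω := Unit) a) r hr).comp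
    (measurable_prodMk_left (x := ()))

/-- The law of the path and of the current measurements when the path is `p`. -/
def obsStep (r : ℕ) (p : Path X U Y r) : Measure (Path X U Y r × (∀ i, Y i)) :=
  (m.channel p.2).map (Prod.mk p)

instance isProbabilityMeasure_obsStep (r : ℕ) (p : Path X U Y r) :
    IsProbabilityMeasure (m.obsStep r p) :=
  Measure.isProbabilityMeasure_map measurable_prodMk_left.aemeasurable

theorem measurable_obsStep (r : ℕ) : Measurable (m.obsStep r) :=
  measurable_map_param (g := fun p : Path X U Y r × (∀ i, Y i) => (p.1, p.2))
    (μ := fun p : Path X U Y r => m.channel p.2)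
    (m.measurable_channel.comp measurable_snd) (fun _ => inferInstance)
    (measurable_fst.prodMk measurable_snd)

/-- A stage is factored into observing and moving. Only the second kernel involves the action, which
is where two actions can be compared. -/
theorem pathLaw_succ (Z : Measure X) (a : BlockAction U Y K) (r : ℕ) (hr : r < K) :
    m.pathLaw Z a (r + 1) hr =
      ((m.pathLaw Z a r hr.le).bind (m.obsStep r)).bind (m.moveLaw a r hr) := by
  rw [Measure.bind_bind (m.measurable_obsStep r).aemeasurable
    (m.measurable_moveLaw a r hr).aemeasurable]
  simp only [pathLaw]
  congr 1
  funext p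
  rw [obsStep, ← Measure.bind_dirac_eq_map _ measurable_prodMk_left,
    Measure.bind_bind (by fun_prop) (m.measurable_moveLaw a r hr).aemeasurable]
  congr 1
  funext y
  rw [Measure.dirac_bind (m.measurable_moveLaw a r hr)]
  rfl

omit [Fintype ι] in
theorem measurable_path_zero : Measurable fun x : X => ((Fin.elim0, x) : Path X U Y 0) :=
  measurable_const.prodMk measurable_id

instance isProbabilityMeasure_pathLaw (Z : Measure X) [IsProbabilityMeasure Z]
    (a : BlockAction U Y K) (r : ℕ) (hr : r ≤ K) : IsProbabilityMeasure (m.pathLaw Z a r hr) := by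
  induction r with
  | zero => 
    exact Measure.isProbabilityMeasure_map (f := fun x : X => ((Fin.elim0, x) : Path X U Y 0))
      measurable_path_zero.aemeasurable
  | succ r ih =>
    rw [pathLaw_succ]
    have := ih (Nat.le_of_succ_le hr)
    have := isProbabilityMeasure_bind_of_measurable (μ := m.pathLaw Z a r (Nat.le_of_succ_le hr))
      (m.measurable_obsStep r) inferInstance
    exact isProbabilityMeasure_bind_of_measurable (m.measurable_moveLaw a r hr) inferInstance

instance isProbabilityMeasure_obsLaw (Z : Measure X) [IsProbabilityMeasure Z]
    (a : BlockAction U Y K) (r : ℕ) (hr : r ≤ K) :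
    IsProbabilityMeasure ((m.pathLaw Z a r hr).bind (m.obsStep r)) :=
  isProbabilityMeasure_bind_of_measurable (m.measurable_obsStep r) inferInstance

theorem measurable_pathLaw (γ : Rule U Y K Ω) {Z : Ω → Measure X} (hZ : Measurable Z)
    (hZ' : ∀ ω, IsProbabilityMeasure (Z ω)) (r : ℕ) (hr : r ≤ K) :
    Measurable fun ω => m.pathLaw (Z ω) (γ.act ω) r hr := by
  induction r with
  | zero => exact (Measure.measurable_map _ measurable_path_zero).comp hZ
  | succ r ih =>
    simp_rw [pathLaw_succ]
    refine measurable_bind_param (κ := fun p => m.moveLaw (γ.act p.1) r hr p.2)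
      (μ := fun ω => (m.pathLaw (Z ω) (γ.act ω) r (Nat.le_of_succ_le hr)).bind (m.obsStep r))
      (measurable_bind_param (κ := fun p : Ω × Path X U Y r => m.obsStep r p.2)
        (ih (Nat.le_of_succ_le hr)) (fun _ => inferInstance)
        ((m.measurable_obsStep r).comp measurable_snd)) (fun _ => inferInstance)
      (m.measurable_moveLaw_param γ r hr)

theorem measurable_pathLaw_dirac (a : BlockAction U Y K) (r : ℕ) (hr : r ≤ K) :
    Measurable fun x => m.pathLaw (Measure.dirac x) a r hr :=
  m.measurable_pathLaw (Rule.const a) Measure.measurable_dirac (fun _ => inferInstance) r hr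

/-- After the initial state, the path evolves by kernels that do not depend on `Z`, so its law is a
mixture over that state. This reduces comparisons of path laws to comparisons of initial laws. -/
theorem pathLaw_eq_bind_dirac (Z : Measure X) (a : BlockAction U Y K) (r : ℕ) (hr : r ≤ K) :
    m.pathLaw Z a r hr = Z.bind fun x => m.pathLaw (Measure.dirac x) a r hr := by
  induction r with
  | zero =>
    simp only [pathLaw]
    simp_rw [Measure.map_dirac' (measurable_path_zero (U := U) (Y := Y))]
    exact (Measure.bind_dirac_eq_map Z measurable_path_zero).symm
  | succ r ih =>
    simp_rw [pathLaw_succ]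
    have hr' := Nat.le_of_succ_le hr
    have ho := (m.measurable_obsStep (U := U) (Y := Y) r)
    have hd := m.measurable_pathLaw_dirac a r hr'
    rw [ih hr', Measure.bind_bind hd.aemeasurable ho.aemeasurable,
      Measure.bind_bind (f := fun x => (m.pathLaw (Measure.dirac x) a r hr').bind (m.obsStep r))
        ((Measure.measurable_bind' ho).comp hd).aemeasurable
        (m.measurable_moveLaw a r hr).aemeasurable]

/-- The expectation of a bounded function of the path depends on the initial law in a Lipschitz
way. -/
theorem integral_pathLaw_le_add_tv (Z Z' : Measure X) [IsProbabilityMeasure Z]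
    [IsProbabilityMeasure Z'] (a : BlockAction U Y K) {F : Path X U Y K → ℝ} (hF : Measurable F)
    {C : ℝ} (hC : ∀ p, |F p| ≤ C) :
    ∫ p, F p ∂(m.pathLaw Z a K le_rfl) ≤
      ∫ p, F p ∂(m.pathLaw Z' a K le_rfl) + C * tv Z Z' := by
  have hd := m.measurable_pathLaw_dirac a K le_rfl
  rw [m.pathLaw_eq_bind_dirac Z, m.pathLaw_eq_bind_dirac Z',
    integral_bind_of_abs_le hd (fun _ => inferInstance) hF hC,
    integral_bind_of_abs_le hd (fun _ => inferInstance) hF hC]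
  exact integral_le_integral_add_tv Z Z'
    (measurable_integral_param (f := fun p => F p.2) hd (fun _ => inferInstance)
      (hF.comp measurable_snd)) fun x => abs_integral_le_of_abs_le hC

/-! ### A countable family of map-valued actions -/

/-- If two map-valued actions disagree with probability at most `δ` at every stage, for every
agent, then the laws of the paths are close. -/
theorem abs_integral_pathLaw_sub_le (Z : Measure X) [IsProbabilityMeasure Z]
    [∀ i, Finite (U i)] [∀ i, DiscreteMeasurableSpace (U i)]
    (a b : BlockAction U Y K) {δ : ℝ}
    (hab : ∀ (r : Fin K) i, ((m.pathLaw Z a r r.2.le).bind (m.obsStep r)).real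
      {q | a.map r i (privateInfo r i q).1 (privateInfo r i q).2 ≠
        b.map r i (privateInfo r i q).1 (privateInfo r i q).2} ≤ δ)
    (r : ℕ) (hr : r ≤ K) {F : Path X U Y r → ℝ} (hF : Measurable F) {C : ℝ} (hC0 : 0 ≤ C)
    (hC : ∀ p, |F p| ≤ C) :
    |∫ p, F p ∂(m.pathLaw Z b r hr) - ∫ p, F p ∂(m.pathLaw Z a r hr)| ≤
      r * (2 * C * (Fintype.card ι * δ)) := by
  induction r with
  | zero => simp [pathLaw]
  | succ r ih =>
    have hr' := Nat.le_of_succ_le hr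
    have ho := m.measurable_obsStep (U := U) (Y := Y) r
    let H : BlockAction U Y K → Path X U Y r × (∀ i, Y i) → ℝ :=
      fun d q => ∫ p, F p ∂(m.moveLaw d r hr q)
    have hHm : ∀ d, Measurable (H d) := fun d =>
      measurable_integral_param (f := fun p => F p.2) (m.measurable_moveLaw d r hr)
        (fun _ => inferInstance) (hF.comp measurable_snd)
    have hHC : ∀ d q, |H d q| ≤ C := fun d q => abs_integral_le_of_abs_le hC
    have hint : ∀ d, ∫ p, F p ∂(m.pathLaw Z d (r + 1) hr) =
        ∫ q, H d q ∂((m.pathLaw Z d r hr').bind (m.obsStep r)) := by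
      intro d
      rw [pathLaw_succ]
      exact integral_bind_of_abs_le (m.measurable_moveLaw d r hr) (fun _ => inferInstance) hF hC
    have hobs : ∀ d, ∫ q, H b q ∂((m.pathLaw Z d r hr').bind (m.obsStep r)) =
        ∫ p, ∫ q, H b q ∂(m.obsStep r p) ∂(m.pathLaw Z d r hr') := fun d =>
      integral_bind_of_abs_le ho (fun _ => inferInstance) (hHm b) (hHC b)
    -- Hybrid argument: keep `b` at the last stage and replace it by `a` at the earlier ones. The
    -- last stage is then changed under the law generated by `a`, the only law in which disagreement
    -- is controlled.
    have h1 := ih hr' (F := fun p => ∫ q, H b q ∂(m.obsStep r p))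
      (measurable_integral_param (f := fun p => H b p.2) ho (fun _ => inferInstance)
        ((hHm b).comp measurable_snd)) fun p => abs_integral_le_of_abs_le (hHC b)
    rw [← hobs, ← hobs] at h1
    set ρ := (m.pathLaw Z a r hr').bind (m.obsStep r)
    let D : ι → Set (Path X U Y r × (∀ i, Y i)) := fun i =>
      {q | a.map ⟨r, hr⟩ i (privateInfo r i q).1 (privateInfo r i q).2 ≠
        b.map ⟨r, hr⟩ i (privateInfo r i q).1 (privateInfo r i q).2}
    have hDm : ∀ i, MeasurableSet (D i) := fun i =>
      (measurableSet_eq_fun ((a.measurable_map ⟨r, hr⟩ i).comp (measurable_privateInfo r i))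
        ((b.measurable_map ⟨r, hr⟩ i).comp (measurable_privateInfo r i))).compl
    -- If no agent disagrees, the joint actions and hence the moves coincide; otherwise the trivial
    -- bound `2 * C` is charged to one disagreeing agent.
    have hpt : ∀ q, |H b q - H a q| ≤ ∑ i, (D i).indicator (fun _ => 2 * C) q := by
      intro q
      have hnn : ∀ i, 0 ≤ (D i).indicator (fun _ => 2 * C) q := fun i =>
        Set.indicator_nonneg (fun _ _ => by linarith) _
      by_cases hq : ∃ i, q ∈ D i
      · obtain ⟨i, hi⟩ := hq
        refine le_trans ?_ (Finset.single_le_sum (fun i _ => hnn i) (Finset.mem_univ i))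
        rw [Set.indicator_of_mem hi]
        have h2 := abs_le.1 (hHC b q)
        have h3 := abs_le.1 (hHC a q)
        exact abs_le.2 ⟨by linarith, by linarith⟩
      · have hu : jointAction b r hr q = jointAction a r hr q := by
          funext i
          by_contra hne
          exact hq ⟨i, fun h => hne h.symm⟩
        have : H b q = H a q := by simp only [H, moveLaw, hu]
        rw [this, sub_self, abs_zero]
        exact Finset.sum_nonneg fun i _ => hnn i
    have h2 : |∫ q, H b q ∂ρ - ∫ q, H a q ∂ρ| ≤ 2 * C * (Fintype.card ι * δ) := by
      rw [← integral_sub (integrable_of_abs_le (hHm b) (hHC b))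
        (integrable_of_abs_le (hHm a) (hHC a))]
      have hii : ∀ i, Integrable ((D i).indicator fun _ => 2 * C) ρ := fun i =>
        (integrable_const _).indicator (hDm i)
      calc |∫ q, (H b q - H a q) ∂ρ| ≤ ∫ q, |H b q - H a q| ∂ρ := abs_integral_le_integral_abs
        _ ≤ ∫ q, ∑ i, (D i).indicator (fun _ => 2 * C) q ∂ρ :=
            integral_mono_of_nonneg (Filter.Eventually.of_forall fun q => abs_nonneg _)
              (integrable_finsetSum _ fun i _ => hii i) (Filter.Eventually.of_forall hpt)
        _ = ∑ i, ρ.real (D i) * (2 * C) := by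
            rw [integral_finsetSum _ fun i _ => hii i]
            refine Finset.sum_congr rfl fun i _ => ?_
            rw [integral_indicator_const _ (hDm i), smul_eq_mul]
        _ ≤ ∑ _i : ι, δ * (2 * C) :=
            Finset.sum_le_sum fun i _ =>
              mul_le_mul_of_nonneg_right (hab ⟨r, hr⟩ i) (by linarith)
        _ = 2 * C * (Fintype.card ι * δ) := by
            rw [Finset.sum_const, Finset.card_univ, nsmul_eq_mul]
            ring
    rw [hint, hint]
    have h3 := abs_sub_le (∫ q, H b q ∂((m.pathLaw Z b r hr').bind (m.obsStep r)))
      (∫ q, H b q ∂ρ) (∫ q, H a q ∂ρ)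
    push_cast
    linarith

/-- For each stage and agent there is a sequence of maps dense in measure for every law of the
private information. Choosing one index for each of the finitely many pairs gives countably many
actions, none depending on `Z`. -/
theorem exists_seq_blockAction_dense [∀ i, Finite (U i)] [∀ i, DiscreteMeasurableSpace (U i)]
    [∀ i, Nonempty (U i)] [∀ i, StandardBorelSpace (Y i)] :
    ∃ act : ℕ → BlockAction U Y K, ∀ (Z : Measure X) [IsProbabilityMeasure Z]
      (a : BlockAction U Y K) (F : Path X U Y K → ℝ) (C : ℝ), Measurable F → (∀ p, |F p| ≤ C) →
      ∀ ε > 0, ∃ n, |∫ p, F p ∂(m.pathLaw Z (act n) K le_rfl) -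
        ∫ p, F p ∂(m.pathLaw Z a K le_rfl)| ≤ ε := by
  choose g hg hdense using fun (r : Fin K) (i : ι) =>
    exists_seq_measurable_dense ((Fin (r + 1) → Y i) × (Fin r → U i)) (U i)
  obtain ⟨e, he⟩ := exists_surjective_nat (Fin K × ι → ℕ)
  refine ⟨fun n => ⟨fun r i y u => g r i (e n (r, i)) (y, u), fun r i => hg r i _⟩,
    fun Z _ a F C hF hC ε hε => ?_⟩
  have hC0 : 0 ≤ C := by
    obtain ⟨p⟩ := nonempty_of_isProbabilityMeasure (m.pathLaw Z a K le_rfl)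
    exact (abs_nonneg _).trans (hC p)
  -- Chosen so that the accumulated disagreement costs at most `ε`; the `+ 1` keeps the denominator
  -- positive when `C = 0` or there are no agents.
  set δ : ℝ := ε / (K * (2 * C * Fintype.card ι) + 1) with hδ
  have hden : 0 < (K * (2 * C * Fintype.card ι) + 1 : ℝ) := by positivity
  have hδ0 : 0 < δ := div_pos hε hden
  choose k hk using fun (r : Fin K) (i : ι) =>
    hdense r i (((m.pathLaw Z a r r.2.le).bind (m.obsStep r)).map (privateInfo r i))
      (fun z => a.map r i z.1 z.2) (a.measurable_map r i) δ hδ0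
  obtain ⟨n, hn⟩ := he fun p => k p.1 p.2
  refine ⟨n, ?_⟩
  refine (m.abs_integral_pathLaw_sub_le Z a _ (δ := δ) (fun r i => ?_) K le_rfl hF hC0 hC).trans ?_
  · have h := hk r i
    have hm : MeasurableSet {z | a.map r i z.1 z.2 ≠ g r i (k r i) z} :=
      (measurableSet_eq_fun (a.measurable_map r i) (hg r i _)).compl
    rw [Measure.map_apply (measurable_privateInfo _ i) hm] at h
    have h' := ((ENNReal.lt_ofReal_iff_toReal_lt (measure_ne_top _ _)).1 h).le
    simp only [hn]
    exact h'
  · have : K * (2 * C * (Fintype.card ι * δ)) = (K * (2 * C * Fintype.card ι)) * δ := by ring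
    rw [this]
    calc (K * (2 * C * Fintype.card ι)) * δ ≤ (K * (2 * C * Fintype.card ι) + 1) * δ := by
          nlinarith
      _ = ε := by rw [hδ]; field_simp

/-! ### The decision processes -/

omit [Fintype ι] in
theorem bddAbove_range_abs_c : BddAbove (Set.range fun p => |m.c p|) := by
  obtain ⟨B, hB⟩ := m.bounded_c
  exact ⟨B, by rintro _ ⟨p, rfl⟩; exact hB p⟩

omit [Fintype ι] in
theorem abs_c_le_costBound (p : X × (∀ i, U i)) : |m.c p| ≤ m.costBound :=
  le_ciSup m.bddAbove_range_abs_c p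

omit [Fintype ι] in
theorem costBound_nonneg : 0 ≤ m.costBound := Real.iSup_nonneg fun _ => abs_nonneg _

/-- The discounted cost of one period along a path. -/
def pathCost (β : ℝ) (p : Path X U Y K) : ℝ :=
  ∑ k : Fin K, β ^ (k : ℕ) * m.c ((p.1 k).1, (p.1 k).2.2)

omit [Fintype ι] in
theorem measurable_pathCost (β : ℝ) : Measurable (m.pathCost β : Path X U Y K → ℝ) := by
  unfold pathCost
  refine Finset.measurable_sum _ fun k _ => (m.measurable_c.comp ?_).const_mul _
  have h : Measurable fun p : Path X U Y K => p.1 k :=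
    (measurable_pi_apply k).comp measurable_fst
  exact (measurable_fst.comp h).prodMk (measurable_snd.comp (measurable_snd.comp h))

/-- A bound for the cost of one period. -/
def periodBound (K : ℕ) (β : ℝ) : ℝ := m.costBound * ((1 - β ^ K) / (1 - β))

omit [Fintype ι] in
theorem abs_pathCost_le {β : ℝ} (hβ0 : 0 ≤ β) (hβ1 : β < 1) (p : Path X U Y K) :
    |m.pathCost β p| ≤ m.periodBound K β := by
  have hsum : ∑ k : Fin K, β ^ (k : ℕ) = (1 - β ^ K) / (1 - β) := by
    rw [Fin.sum_univ_eq_sum_range fun k => β ^ k, geom_sum_eq hβ1.ne, ← neg_div_neg_eq]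
    simp
  calc |m.pathCost β p| ≤ ∑ k : Fin K, |β ^ (k : ℕ) * m.c ((p.1 k).1, (p.1 k).2.2)| :=
        Finset.abs_sum_le_sum_abs _ _
    _ ≤ ∑ k : Fin K, m.costBound * β ^ (k : ℕ) := by
        refine Finset.sum_le_sum fun k _ => ?_
        rw [abs_mul, abs_of_nonneg (pow_nonneg hβ0 _), mul_comm]
        exact mul_le_mul_of_nonneg_right (m.abs_c_le_costBound _) (pow_nonneg hβ0 _)
    _ = m.periodBound K β := by rw [← Finset.mul_sum, hsum, periodBound]

/-- The measurements and actions along a path. -/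
def pathBlock (p : Path X U Y K) : Block U Y K := fun k => (p.1 k).2

omit [Fintype ι] in
theorem measurable_pathBlock : Measurable (pathBlock : Path X U Y K → Block U Y K) :=
  measurable_pi_lambda _ fun k => measurable_snd.comp ((measurable_pi_apply k).comp measurable_fst)

theorem measurable_nextState_right (s : State X U Y K M) :
    Measurable (m.nextState s : Block U Y K → State X U Y K M) := by
  have h := m.measurable_nextState.comp (measurable_prodMk_left (x := s))
  exact h

theorem trans_eq_map (s : State X U Y K M) (a : BlockAction U Y K) :
    m.trans s a = (m.pathLaw (m.predictor s) a K le_rfl).map fun p =>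
      m.nextState s (pathBlock p) :=
  Measure.map_map (m.measurable_nextState_right s) measurable_pathBlock

theorem measurable_pathLaw_predictor (γ : Rule U Y K Ω) {f : Ω → State X U Y K M}
    (hf : Measurable f) :
    Measurable fun ω => m.pathLaw (m.predictor (f ω) : Measure X) (γ.act ω) K le_rfl :=
  m.measurable_pathLaw γ (Z := fun ω => (m.predictor (f ω) : Measure X))
    (m.measurable_predictor_measure.comp hf) (fun _ => inferInstance) K le_rfl

theorem measurable_trans_param (γ : Rule U Y K Ω) {f : Ω → State X U Y K M} (hf : Measurable f) :
    Measurable fun ω => m.trans (f ω) (γ.act ω) := by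
  simp_rw [trans_eq_map]
  have h : Measurable fun p : Ω × Path X U Y K => (f p.1, pathBlock p.2) :=
    (hf.comp measurable_fst).prodMk (measurable_pathBlock.comp measurable_snd)
  have h' := m.measurable_nextState.comp h
  exact measurable_map_param (g := fun p => m.nextState (f p.1) (pathBlock p.2))
    (m.measurable_pathLaw_predictor γ hf) (fun _ => inferInstance) h'

theorem measurable_cost_param (β : ℝ) (γ : Rule U Y K Ω) {f : Ω → State X U Y K M}
    (hf : Measurable f) : Measurable fun ω => m.cost β (f ω) (γ.act ω) :=
  measurable_integral_param (f := fun p => m.pathCost β p.2)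
    (m.measurable_pathLaw_predictor γ hf) (fun _ => inferInstance)
    ((m.measurable_pathCost β).comp measurable_snd)

instance isProbabilityMeasure_trans (s : State X U Y K M) (a : BlockAction U Y K) :
    IsProbabilityMeasure (m.trans s a) := by
  rw [trans_eq_map]
  exact Measure.isProbabilityMeasure_map
    ((m.measurable_nextState_right s).comp measurable_pathBlock).aemeasurable

theorem abs_cost_le {β : ℝ} (hβ0 : 0 ≤ β) (hβ1 : β < 1) (s : State X U Y K M)
    (a : BlockAction U Y K) : |m.cost β s a| ≤ m.periodBound K β :=
  abs_integral_le_of_abs_le fun p => m.abs_pathCost_le hβ0 hβ1 p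

theorem isBoundedMDP {β : ℝ} (hβ0 : 0 ≤ β) (hβ1 : β < 1) :
    IsBoundedMDP (m.trans : State X U Y K M → _) (m.cost β) (m.periodBound K β) where
  prob _ _ := inferInstance
  measurable_trans_history _ γ := m.measurable_trans_param γ (measurable_pi_apply _)
  measurable_cost_history _ γ := m.measurable_cost_param β γ (measurable_pi_apply _)
  abs_cost_le := m.abs_cost_le hβ0 hβ1

theorem isBoundedMDP_approx {β : ℝ} (hβ0 : 0 ≤ β) (hβ1 : β < 1) (πs : ProbabilityMeasure X) :
    IsBoundedMDP (m.approxTrans πs : Window U Y K M → _) (m.approxCost β πs)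
      (m.periodBound K β) where
  prob _ _ := Measure.isProbabilityMeasure_map measurable_snd.aemeasurable
  measurable_trans_history _ γ := (Measure.measurable_map _ measurable_snd).comp
    (m.measurable_trans_param γ (measurable_const.prodMk (measurable_pi_apply _)))
  measurable_cost_history _ γ := m.measurable_cost_param β γ
    (measurable_const.prodMk (measurable_pi_apply _))
  abs_cost_le _ _ := m.abs_cost_le hβ0 hβ1 _ _

/-! ### Comparing Bellman expressions of the true and the approximate process. -/

section Bellman

variable {β b D : ℝ}

theorem measurable_pathCost_add (s : State X U Y K M) {V : State X U Y K M → ℝ}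
    (hV : Measurable V) : Measurable fun p : Path X U Y K =>
      m.pathCost β p + b * V (m.nextState s (pathBlock p)) :=
  (m.measurable_pathCost β).add ((hV.comp
    ((m.measurable_nextState_right s).comp measurable_pathBlock)).const_mul b)

theorem abs_pathCost_add_le (hβ0 : 0 ≤ β) (hβ1 : β < 1) (hb0 : 0 ≤ b) (s : State X U Y K M)
    {V : State X U Y K M → ℝ} (hV : ∀ s, |V s| ≤ D) (p : Path X U Y K) :
    |m.pathCost β p + b * V (m.nextState s (pathBlock p))| ≤ m.periodBound K β + b * D := by
  refine (abs_add_le _ _).trans (add_le_add (m.abs_pathCost_le hβ0 hβ1 p) ?_)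
  rw [abs_mul, abs_of_nonneg hb0]
  exact mul_le_mul_of_nonneg_left (hV _) hb0

/-- The period cost and the next state are functions of one path. A single integral allows the
Lipschitz and density estimates to be applied once, with the combined bound. -/
theorem bellman_eq_integral (hβ0 : 0 ≤ β) (hβ1 : β < 1) (s : State X U Y K M)
    (a : BlockAction U Y K) {V : State X U Y K M → ℝ} (hVm : Measurable V)
    (hV : ∀ s, |V s| ≤ D) :
    bellman m.trans (m.cost β) b V s a =
      ∫ p, (m.pathCost β p + b * V (m.nextState s (pathBlock p)))
        ∂(m.pathLaw (m.predictor s) a K le_rfl) := by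
  have hm : Measurable fun p : Path X U Y K => m.nextState s (pathBlock p) :=
    (m.measurable_nextState_right s).comp measurable_pathBlock
  have hVi : Measurable fun p : Path X U Y K => V (m.nextState s (pathBlock p)) := hVm.comp hm
  rw [integral_add (integrable_of_abs_le (m.measurable_pathCost β)
    (m.abs_pathCost_le hβ0 hβ1)) ((integrable_of_abs_le hVi fun p => hV _).const_mul b),
    integral_const_mul, bellman, trans_eq_map,
    integral_map hm.aemeasurable hVm.aestronglyMeasurable]
  rfl

/-- Resetting the predictor component is invisible to a cost-to-go that reads only the window. -/
theorem bellman_approx (πs : ProbabilityMeasure X) (w : Window U Y K M) (a : BlockAction U Y K)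
    {V : Window U Y K M → ℝ} (hVm : Measurable V) :
    bellman (m.approxTrans πs) (m.approxCost β πs) b V w a =
      bellman m.trans (m.cost β) b (fun s => V s.2) (πs, w) a := by
  unfold bellman approxTrans
  rw [integral_map measurable_snd.aemeasurable hVm.aestronglyMeasurable]
  rfl

/-- Two states with the same window differ, in the Bellman equation for a function of the window,
only through their current predictors. -/
theorem bellman_le_add_tv (hβ0 : 0 ≤ β) (hβ1 : β < 1) (hb0 : 0 ≤ b) (s s' : State X U Y K M)
    (hs : s.2 = s'.2) (a : BlockAction U Y K) {V : Window U Y K M → ℝ} (hVm : Measurable V)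
    (hV : ∀ w, |V w| ≤ D) :
    bellman m.trans (m.cost β) b (fun s => V s.2) s a ≤
      bellman m.trans (m.cost β) b (fun s => V s.2) s' a +
        (m.periodBound K β + b * D) * tv (m.predictor s : Measure X) (m.predictor s') := by
  have hVm' : Measurable fun s : State X U Y K M => V s.2 := hVm.comp measurable_snd
  rw [m.bellman_eq_integral hβ0 hβ1 s a hVm' fun _ => hV _,
    m.bellman_eq_integral hβ0 hβ1 s' a hVm' fun _ => hV _]
  -- Now both integrands are the same function of the path, and only the initial laws differ.
  simp_rw [nextState_snd, ← hs]
  exact m.integral_pathLaw_le_add_tv _ _ a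
    (m.measurable_pathCost_add s hVm') (m.abs_pathCost_add_le hβ0 hβ1 hb0 s fun _ => hV _)

theorem exists_seq_bellman_dense [∀ i, Finite (U i)] [∀ i, DiscreteMeasurableSpace (U i)]
    [∀ i, Nonempty (U i)] [∀ i, StandardBorelSpace (Y i)] (hβ0 : 0 ≤ β) (hβ1 : β < 1)
    (hb0 : 0 ≤ b) :
    ∃ act : ℕ → BlockAction U Y K, ∀ V : State X U Y K M → ℝ, ∀ D, Measurable V →
      (∀ s, |V s| ≤ D) → ∀ s a, ∀ ε > 0, ∃ n,
        bellman m.trans (m.cost β) b V s (act n) ≤ bellman m.trans (m.cost β) b V s a + ε := by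
  obtain ⟨act, hact⟩ := m.exists_seq_blockAction_dense (K := K)
  refine ⟨act, fun V D hVm hV s a ε hε => ?_⟩
  obtain ⟨n, hn⟩ := hact (m.predictor s) a _ _ (m.measurable_pathCost_add (β := β) (b := b) s hVm)
    (m.abs_pathCost_add_le hβ0 hβ1 hb0 s hV) ε hε
  refine ⟨n, ?_⟩
  rw [m.bellman_eq_integral hβ0 hβ1 s _ hVm hV, m.bellman_eq_integral hβ0 hβ1 s _ hVm hV]
  linarith [(abs_le.1 hn).2]

end Bellman

end Model

end Model

/-! ### Accumulated predictor error and constants. -/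

section Model

variable {ι : Type*} [Fintype ι] {X : Type*} [MeasurableSpace X] {U Y : ι → Type*}
  [∀ i, MeasurableSpace (U i)] [∀ i, MeasurableSpace (Y i)]

namespace Model

variable (m : Model X U Y) {K M : ℕ}

/-- The distance between the true and the approximate predictor in the state `s`. -/
def predictorDist (πs : ProbabilityMeasure X) (s : State X U Y K M) : ℝ :=
  tv (m.predictor s : Measure X) (m.predictor (πs, s.2) : Measure X)

theorem abs_predictorDist_le (πs : ProbabilityMeasure X) (s : State X U Y K M) :
    |m.predictorDist πs s| ≤ 2 := by
  rw [predictorDist, abs_of_nonneg (tv_nonneg _ _)]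
  exact tv_le_two _ _

theorem measurable_predictorDist [StandardBorelSpace X] (πs : ProbabilityMeasure X) :
    Measurable (m.predictorDist πs : State X U Y K M → ℝ) := by
  have h : Measurable fun s : State X U Y K M => ((πs, s.2) : State X U Y K M) :=
    measurable_const.prodMk measurable_snd
  have h' : Measurable fun s : State X U Y K M => (m.predictor (πs, s.2) : Measure X) :=
    m.measurable_predictor_measure.comp h
  exact measurable_tv m.measurable_predictor_measure h' (fun _ => inferInstance)
    (fun _ => inferInstance)

variable {β b : ℝ}

theorem integral_predictorDist_le_two (hβ0 : 0 ≤ β) (hβ1 : β < 1) (πs : ProbabilityMeasure X)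
    (ν : Measure (State X U Y K M)) [IsProbabilityMeasure ν] (γ : Rule U Y K (State X U Y K M))
    (q : ℕ) :
    ∫ p, m.predictorDist πs (p (Fin.last q)) ∂(stateLaw m.trans (stationary γ) ν q) ≤ 2 :=
  (le_abs_self _).trans ((m.isBoundedMDP hβ0 hβ1).abs_integral_stateLaw_le (stationary γ) ν
    fun _ => m.abs_predictorDist_le πs _)

theorem integral_predictorDist_le_predictorError (hβ0 : 0 ≤ β) (hβ1 : β < 1)
    (πs : ProbabilityMeasure X) (ν : Measure (State X U Y K M)) [IsProbabilityMeasure ν]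
    (γ : Rule U Y K (State X U Y K M)) (q : ℕ) :
    ∫ p, m.predictorDist πs (p (Fin.last q)) ∂(stateLaw m.trans (stationary γ) ν q) ≤
      m.predictorError πs ν q := by
  -- The bound `2` on total variation makes the real supremum a genuine upper bound.
  refine le_ciSup (f := fun γ : Rule U Y K (State X U Y K M) =>
    ∫ p, m.predictorDist πs (p (Fin.last q)) ∂(stateLaw m.trans (stationary γ) ν q)) ⟨2, ?_⟩ γ
  rintro _ ⟨γ', rfl⟩
  exact m.integral_predictorDist_le_two hβ0 hβ1 πs ν γ' q

theorem abs_predictorError_le_two (hβ0 : 0 ≤ β) (hβ1 : β < 1) (πs : ProbabilityMeasure X)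
    (ν : Measure (State X U Y K M)) [IsProbabilityMeasure ν] (q : ℕ) :
    |m.predictorError πs ν q| ≤ 2 := by
  have h0 : 0 ≤ m.predictorError πs ν q :=
    Real.iSup_nonneg fun γ => integral_nonneg fun _ => tv_nonneg _ _
  rw [abs_of_nonneg h0]
  exact Real.iSup_le (fun γ => m.integral_predictorDist_le_two hβ0 hβ1 πs ν γ q) zero_le_two

/-- A bounded function which decreases at most by a multiple of the distance of the predictors
along a stationary Markov policy is bounded in mean by the total predictor error. -/
theorem integral_le_tsum_predictorError [StandardBorelSpace X] (hβ0 : 0 ≤ β) (hβ1 : β < 1)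
    (hb0 : 0 ≤ b) (hb1 : b < 1) (πs : ProbabilityMeasure X) (ν : Measure (State X U Y K M))
    [IsProbabilityMeasure ν] (γ : Rule U Y K (State X U Y K M)) {V : State X U Y K M → ℝ}
    {D C ε : ℝ} (hC : 0 ≤ C) (hVm : Measurable V) (hV : ∀ s, |V s| ≤ D)
    (hle : ∀ s, V s ≤ C * m.predictorDist πs s + ε + b * ∫ s', V s' ∂(m.trans s (γ.act s))) :
    ∫ s, V s ∂ν ≤ C * ∑' q, b ^ q * m.predictorError πs ν q + ε / (1 - b) := by
  have h := m.isBoundedMDP (K := K) (M := M) hβ0 hβ1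
  have hf : ∀ s : State X U Y K M, |C * m.predictorDist πs s + ε| ≤ C * 2 + |ε| := by
    intro s
    refine (abs_add_le _ _).trans (add_le_add ?_ le_rfl)
    rw [abs_mul, abs_of_nonneg hC]
    exact mul_le_mul_of_nonneg_left (m.abs_predictorDist_le πs s) hC
  have hfm : Measurable fun s : State X U Y K M => C * m.predictorDist πs s + ε :=
    ((m.measurable_predictorDist πs).const_mul C).add_const ε
  have hsL : Summable fun q => b ^ q * m.predictorError πs ν q :=
    summable_geometric_mul hb0 hb1 fun q => m.abs_predictorError_le_two hβ0 hβ1 πs ν q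
  have hsε : Summable fun q : ℕ => b ^ q * ε :=
    (summable_geometric_of_lt_one hb0 hb1).mul_right ε
  refine (h.integral_le_tsum hb0 hb1 (stationary γ) ν hVm hV
    (f := fun q p => C * m.predictorDist πs (p (Fin.last q)) + ε)
    (fun q => hfm.comp (measurable_pi_apply _)) (fun q p => hf _) fun q p => hle _).trans ?_
  have hq : ∀ q, ∫ p, (C * m.predictorDist πs (p (Fin.last q)) + ε)
      ∂(stateLaw m.trans (stationary γ) ν q) ≤ C * m.predictorError πs ν q + ε := by
    intro q
    have := h.isProbabilityMeasure_stateLaw (stationary γ) ν q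
    have hm : Measurable fun p : Fin (q + 1) → State X U Y K M =>
        m.predictorDist πs (p (Fin.last q)) :=
      (m.measurable_predictorDist πs).comp (measurable_pi_apply _)
    rw [integral_add ((h.integrable_stateLaw (stationary γ) ν hm
      fun p => m.abs_predictorDist_le πs _).const_mul C) (integrable_const ε), integral_const_mul]
    simpa using mul_le_mul_of_nonneg_left
      (m.integral_predictorDist_le_predictorError hβ0 hβ1 πs ν γ q) hC
  calc ∑' q, b ^ q * ∫ p, (C * m.predictorDist πs (p (Fin.last q)) + ε)
        ∂(stateLaw m.trans (stationary γ) ν q)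
      ≤ ∑' q, (C * (b ^ q * m.predictorError πs ν q) + b ^ q * ε) := by
        refine (summable_geometric_mul hb0 hb1 fun q =>
          h.abs_integral_stateLaw_le (stationary γ) ν fun p => hf _).tsum_le_tsum (fun q => ?_)
          ((hsL.mul_left C).add hsε)
        refine (mul_le_mul_of_nonneg_left (hq q) (pow_nonneg hb0 q)).trans_eq ?_
        ring
    _ = C * ∑' q, b ^ q * m.predictorError πs ν q + ε / (1 - b) := by
        rw [(hsL.mul_left C).tsum_add hsε, tsum_mul_left, tsum_mul_right,
          tsum_geometric_of_lt_one hb0 hb1, div_eq_inv_mul]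

omit [Fintype ι] in
theorem periodBound_div (hβ0 : 0 ≤ β) (hβ1 : β < 1) (hK : 0 < K) :
    m.periodBound K β / (1 - β ^ K) = m.costBound / (1 - β) := by
  have h1 : 1 - β ^ K ≠ 0 := by linarith [pow_lt_one₀ hβ0 hβ1 hK.ne']
  have h2 : 1 - β ≠ 0 := by linarith
  unfold periodBound
  field_simp

omit [Fintype ι] in
-- One period plus the discounted future is the whole horizon. This makes the Lipschitz constant of
-- the Bellman comparison exactly `‖c‖_∞ / (1 - β)`.
theorem periodBound_add (hβ0 : 0 ≤ β) (hβ1 : β < 1) (hK : 0 < K) :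
    m.periodBound K β + β ^ K * (m.costBound / (1 - β)) = m.costBound / (1 - β) := by
  have h1 : 1 - β ^ K ≠ 0 := by linarith [pow_lt_one₀ hβ0 hβ1 hK.ne']
  rw [← m.periodBound_div hβ0 hβ1 hK]
  field_simp
  ring

end Model

end Model

end PeriodicSharing

end

/-! ### The loss bound. -/

theorem mainTheorem3 {ι : Type*} [Fintype ι] {X : Type*} [MeasurableSpace X]
    [StandardBorelSpace X] {U Y : ι → Type*}
    [∀ i, Finite (U i)] [∀ i, MeasurableSpace (U i)] [∀ i, DiscreteMeasurableSpace (U i)]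
    [∀ i, MeasurableSpace (Y i)] [∀ i, StandardBorelSpace (Y i)]
    (m : PeriodicSharing.Model X U Y) (β : ℝ) (hβ0 : 0 < β) (hβ1 : β < 1)
    (K M : ℕ) (hK : 0 < K) (πs : ProbabilityMeasure X)
    (γs : PeriodicSharing.Rule U Y K (PeriodicSharing.Window U Y K M))
    (hγs : PeriodicSharing.IsOptimal (m.approxTrans πs) (m.approxCost β πs) (β ^ K) γs)
    (ν : Measure (PeriodicSharing.State X U Y K M)) [IsProbabilityMeasure ν] :
    Summable (fun q : ℕ => (β ^ K) ^ q * m.predictorError πs ν q) ∧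
    Integrable (fun s : PeriodicSharing.State X U Y K M =>
      PeriodicSharing.policyCost m.trans (m.cost β) (β ^ K)
          (PeriodicSharing.stationary (γs.comap Prod.snd measurable_snd)) s -
        PeriodicSharing.optimalCost m.trans (m.cost β) (β ^ K) s) ν ∧
    ∫ s, (PeriodicSharing.policyCost m.trans (m.cost β) (β ^ K)
          (PeriodicSharing.stationary (γs.comap Prod.snd measurable_snd)) s -
        PeriodicSharing.optimalCost m.trans (m.cost β) (β ^ K) s) ∂ν ≤
      2 * (m.costBound / (1 - β)) * ∑' q : ℕ, (β ^ K) ^ q * m.predictorError πs ν q := by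
  open PeriodicSharing PeriodicSharing.Model in
  have hb0 : 0 ≤ β ^ K := by positivity
  have hb1 : β ^ K < 1 := pow_lt_one₀ hβ0.le hβ1 hK.ne'
  -- The dense family needs nonempty action spaces; evaluating the given policy at stage `0`, which
  -- exists as `K` is positive, provides elements.
  have hU : ∀ i, Nonempty (U i) := by
    intro i
    obtain ⟨s⟩ := nonempty_of_isProbabilityMeasure ν
    obtain ⟨y⟩ := nonempty_of_isProbabilityMeasure (m.ψ i)
    exact ⟨(γs.act s.2).map ⟨0, hK⟩ i (fun _ => y) Fin.elim0⟩
  have h := m.isBoundedMDP (K := K) (M := M) hβ0.le hβ1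
  have ha := m.isBoundedMDP_approx (K := K) (M := M) hβ0.le hβ1 πs
  obtain ⟨act, hact⟩ := m.exists_seq_bellman_dense (K := K) (M := M) hβ0.le hβ1 hb0
  obtain ⟨hVm, hV, hgreedy⟩ := h.optimalCost_of_dense hb0 hb1 act hact
  obtain ⟨hWm, hW, hWfix⟩ := h.policyCost_stationary hb0 hb1 (γs.comap Prod.snd measurable_snd)
  obtain ⟨hAm, hA, hAfix⟩ := ha.policyCost_stationary hb0 hb1 γs
  have hAle := fun w a => ha.le_bellman_of_isOptimal hb0 hb1 hγs w a
  rw [m.periodBound_div hβ0.le hβ1 hK] at hV hW hA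
  set V := optimalCost m.trans (m.cost β) (β ^ K) (S := State X U Y K M)
  set W := policyCost m.trans (m.cost β) (β ^ K)
    (stationary (γs.comap Prod.snd measurable_snd) : Policy U Y K (State X U Y K M))
  set A := policyCost (m.approxTrans πs) (m.approxCost β πs) (β ^ K) (stationary γs)
  set C := m.costBound / (1 - β)
  have hC0 : 0 ≤ C := div_nonneg m.costBound_nonneg (by linarith)
  have hAm' : Measurable fun s : State X U Y K M => A s.2 := hAm.comp measurable_snd
  have hcmp : ∀ (s : State X U Y K M) a,
      bellman m.trans (m.cost β) (β ^ K) (fun s => A s.2) s a ≤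
        bellman (m.approxTrans πs) (m.approxCost β πs) (β ^ K) A s.2 a +
          C * m.predictorDist πs s ∧
      bellman (m.approxTrans πs) (m.approxCost β πs) (β ^ K) A s.2 a ≤
        bellman m.trans (m.cost β) (β ^ K) (fun s => A s.2) s a +
          C * m.predictorDist πs s := by
    intro s a
    have h1 := m.bellman_le_add_tv hβ0.le hβ1 hb0 s (πs, s.2) rfl a hAm hA
    have h2 := m.bellman_le_add_tv hβ0.le hβ1 hb0 (πs, s.2) s rfl a hAm hA
    rw [m.periodBound_add hβ0.le hβ1 hK] at h1 h2
    rw [tv_comm] at h2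
    rw [m.bellman_approx πs s.2 a hAm]
    exact ⟨h1, h2⟩
  have hsub : ∀ {F G : State X U Y K M → ℝ}, Measurable F → (∀ s, |F s| ≤ C) → Measurable G →
      (∀ s, |G s| ≤ C) → ∀ s a, β ^ K * ∫ s', (F s' - G s') ∂(m.trans s a) =
        bellman m.trans (m.cost β) (β ^ K) F s a - bellman m.trans (m.cost β) (β ^ K) G s a := by
    intro F G hF hF' hG hG' s a
    rw [integral_sub (integrable_of_abs_le hF hF') (integrable_of_abs_le hG hG'), bellman, bellman]
    ring
  have hbd : ∀ {F G : State X U Y K M → ℝ}, (∀ s, |F s| ≤ C) → (∀ s, |G s| ≤ C) →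
      ∀ s, |F s - G s| ≤ C + C := fun hF hG s =>
    (abs_sub _ _).trans (add_le_add (hF s) (hG s))
  -- Here the same policy is run in both processes, and both Bellman equations are exact, so no
  -- slack is needed.
  have first : ∫ s, (W s - A s.2) ∂ν ≤
      C * ∑' q : ℕ, (β ^ K) ^ q * m.predictorError πs ν q := by
    have := m.integral_le_tsum_predictorError hβ0.le hβ1 hb0 hb1 πs ν
      (γs.comap Prod.snd measurable_snd) (V := fun s => W s - A s.2) (ε := 0) hC0 (hWm.sub hAm')
      (hbd hW fun s => hA s.2) (fun s => by
        rw [hsub hWm hW hAm' fun s => hA s.2]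
        have h1 := hWfix s
        have h2 := hAfix s.2
        have h3 := (hcmp s (γs.act s.2)).1
        simp only [Rule.comap] at h1 ⊢
        linarith)
    simpa using this
  -- Here the true process follows a policy nearly greedy for `V`; its actions may be suboptimal in
  -- the approximate process, which is the favorable direction for `A`.
  have second : ∫ s, (A s.2 - V s) ∂ν ≤
      C * ∑' q : ℕ, (β ^ K) ^ q * m.predictorError πs ν q := by
    refine le_of_forall_pos_le_add fun ε hε => ?_
    obtain ⟨γ, hγ⟩ := hgreedy (ε * (1 - β ^ K)) (mul_pos hε (by linarith))
    have := m.integral_le_tsum_predictorError hβ0.le hβ1 hb0 hb1 πs ν γ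
      (V := fun s => A s.2 - V s) (ε := ε * (1 - β ^ K)) hC0 (hAm'.sub hVm)
      (hbd (fun s => hA s.2) hV) (fun s => by
        rw [hsub hAm' (fun s => hA s.2) hVm hV]
        have h1 := hγ s
        have h2 := hAle s.2 (γ.act s)
        have h3 := (hcmp s (γ.act s)).2
        linarith)
    rwa [mul_div_cancel_right₀ _ (by linarith : (1 - β ^ K) ≠ 0)] at this
  refine ⟨summable_geometric_mul hb0 hb1 fun q =>
    m.abs_predictorError_le_two hβ0.le hβ1 πs ν q,
    integrable_of_abs_le (hWm.sub hVm) (hbd hW hV), ?_⟩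
  have hsplit : ∫ s, (W s - V s) ∂ν = ∫ s, (W s - A s.2) ∂ν + ∫ s, (A s.2 - V s) ∂ν := by
    rw [← integral_add (f := fun s => W s - A s.2) (g := fun s => A s.2 - V s)
      (integrable_of_abs_le (hWm.sub hAm') (hbd hW fun s => hA s.2))
      (integrable_of_abs_le (hAm'.sub hVm) (hbd (fun s => hA s.2) hV))]
    simp
  rw [hsplit]
  linarith
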